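/- Let $p$ be an odd prime and $n\ge 0$ an integer. A central decomposition of a group $G$ is a set of subgroups of $G$ such that distinct members commute elementwise and which generates $G$, while no proper subset of it generates $G$; $G$ is centrally indecomposable if $\{G\}$ is its only central decomposition; a central decomposition is fully refined if all its members are centrally indecomposable. For a group $H$ and $k\geq 0$ let $\overbrace{H\circ\cdots\circ H}^{k}=H^k/N$, where $N$ is generated by the elements with $x$ in position $i$, $x^{-1}$ in position $j$ and $1$ elsewhere, for $i<j$ and $x\in Z(H)$. Let $H=\langle x,y,z\mid \text{class }2,\text{ exponent }p\rangle$ be the free group of rank $3$ in the variety of groups of class at most $2$ and exponent dividing $p$, let $X=\{x,y,z\}$, and let $P=\overbrace{H\circ\cdots\circ H}^{2n}$. For $u\in H$ write $u_i$ for the image in $P$ of the element of $H^{2n}$ with $u$ in position $i$ and $1$ elsewhere, and put $H_i=\langle u_i: u\in X\rangle$. Let $\alpha,\beta\in\mathbb{Z}/p$ be such that $\alpha^2+\beta^2$ is not a square. For $0\le m\le n$ put $\mathcal{H}_m=\{K_1,\dots,K_{2m},H_{2m+1},\dots,H_{2n}\}$, where $$K_{2j-1}=\langle u_{2j-1}^{\alpha}u_{2j}^{\beta}: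 u\in X\rangle,\qquad K_{2j}=\langle u_{2j-1}^{\beta}u_{2j}^{-\alpha}: u\in X\rangle\qquad(1\le j\le m).$$ Then: (i) for $0\le m\le n$ every member of $\mathcal{H}_m$ is isomorphic to $H$; (ii) for $0\le m\le n$, $\mathcal{H}_m$ is a fully refined central decomposition of $P$; (iii) for every fully refined central decomposition $\mathcal{K}$ of $P$ there is exactly one $m\in\{0,\dots,n\}$ such that some automorphism of $P$ that fixes the commutator subgroup $P'$ pointwise maps $\mathcal{K}$ to $\mathcal{H}_m$; so $C_{\operatorname{Aut}P}(P')$ has exactly $1+n$ orbits on the set of fully refined central decompositions of $P$; (iv) for $0\le m,m'\le n$, $\mathcal{H}_m$ and $\mathcal{H}_{m'}$ are in the same $\operatorname{Aut}P$-orbit if and only if $m'=m$ or $m'=n-m$. Hence $\operatorname{Aut}P$ has exactly $1+\lfloor n/2\rfloor$ orbits on the set of fully refined central decompositions of $P$. -/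

import Mathlib

open scoped Pointwise commutatorElement

/-- A central decomposition of `G`: a set of subgroups in which distinct members commute
elementwise and which generates `G`, while no proper subset of it generates `G`. -/
def IsCentralDecomposition {G : Type*} [Group G] (𝓗 : Set (Subgroup G)) : Prop :=
  (∀ H ∈ 𝓗, ∀ K ∈ 𝓗, H ≠ K → ∀ x ∈ H, ∀ y ∈ K, Commute x y) ∧
  sSup 𝓗 = ⊤ ∧
  ∀ 𝓙 : Set (Subgroup G), 𝓙 ⊂ 𝓗 → sSup 𝓙 ≠ ⊤

/-- `G` is centrally indecomposable if its only central decomposition is `{G}`. (For a nontrivial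
group `{G}` always is a central decomposition; the trivial group has only the empty one and is not
centrally indecomposable.) -/
def IsCentrallyIndecomposable (G : Type*) [Group G] : Prop :=
  ∀ 𝓗 : Set (Subgroup G), IsCentralDecomposition 𝓗 → 𝓗 = {⊤}

/-- A central decomposition is fully refined if all its members are centrally indecomposable. -/
def IsFullyRefined {G : Type*} [Group G] (𝓗 : Set (Subgroup G)) : Prop :=
  IsCentralDecomposition 𝓗 ∧ ∀ H ∈ 𝓗, IsCentrallyIndecomposable H

/-- The subgroup `N` of `H × ⋯ × H` (`k` factors) generated by the elements with `x` in position
`i`, `x⁻¹` in position `j` and `1` elsewhere, for `i < j` and `x ∈ Z(H)`. -/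
def centralPowerKernel (H : Type*) [Group H] (k : ℕ) : Subgroup (Fin k → H) :=
  Subgroup.closure {g | ∃ i j : Fin k, i < j ∧ ∃ x ∈ Subgroup.center H,
    g = Pi.mulSingle i x * Pi.mulSingle j x⁻¹}

theorem mulSingle_mem_center {H : Type*} [Group H] {k : ℕ} (i : Fin k) {x : H}
    (hx : x ∈ Subgroup.center H) :
    (Pi.mulSingle i x : Fin k → H) ∈ Subgroup.center (Fin k → H) := by
  rw [Subgroup.mem_center_iff] at hx ⊢
  intro g
  ext l
  by_cases h : l = i
  · subst h
    simpa using hx (g l)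
  · simp [Pi.mulSingle_eq_of_ne h]

theorem centralPowerKernel_le_center (H : Type*) [Group H] (k : ℕ) :
    centralPowerKernel H k ≤ Subgroup.center (Fin k → H) := by
  unfold centralPowerKernel
  rw [Subgroup.closure_le]
  rintro g ⟨i, j, -, x, hx, rfl⟩
  exact mul_mem (mulSingle_mem_center i hx) (mulSingle_mem_center j (inv_mem hx))

instance centralPowerKernel_normal (H : Type*) [Group H] (k : ℕ) :
    (centralPowerKernel H k).Normal :=
  ⟨fun x hx g => by
    have h := Subgroup.mem_center_iff.1 (centralPowerKernel_le_center H k hx) g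
    rw [h, mul_inv_cancel_right]
    exact hx⟩

/-- The canonical central product `H ∘ ⋯ ∘ H` of `k` copies of `H`. -/
abbrev CentralPower (H : Type*) [Group H] (k : ℕ) : Type _ :=
  (Fin k → H) ⧸ centralPowerKernel H k

/-- The homomorphism `x ↦ xᵢ` from `H` onto the `i`-th component of `H ∘ ⋯ ∘ H`. -/
def CentralPower.component {H : Type*} [Group H] {k : ℕ} (i : Fin k) : H →* CentralPower H k :=
  (QuotientGroup.mk' (centralPowerKernel H k)).comp (MonoidHom.mulSingle (fun _ => H) i)

/-- The subgroup `Hᵢ = ⟨xᵢ : x ∈ X⟩` of `H ∘ ⋯ ∘ H`. -/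
def componentSubgroup {H : Type*} [Group H] (X : Set H) {k : ℕ} (i : Fin k) :
    Subgroup (CentralPower H k) :=
  Subgroup.closure ((fun x => CentralPower.component i x) '' X)

/-- The subgroup `⟨xᵢ ^ α * xⱼ ^ β : x ∈ X⟩` of `H ∘ ⋯ ∘ H`. The exponents are residues
modulo `p`; the groups `H` that are used here have exponent `p`. -/
def twistedSubgroup {H : Type*} [Group H] (X : Set H) {k p : ℕ} (i j : Fin k) (α β : ZMod p) :
    Subgroup (CentralPower H k) :=
  Subgroup.closure ((fun x =>
    CentralPower.component i x ^ α.val * CentralPower.component j x ^ β.val) '' X)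

/-- The set `𝓗ₘ = {K₁, …, K₂ₘ, H₂ₘ₊₁, …, H₂ₙ}` of subgroups of the `2n`-fold central product of
`H = ⟨X⟩`, where `K₂ⱼ₋₁ = ⟨x₂ⱼ₋₁ ^ α * x₂ⱼ ^ β : x ∈ X⟩` and
`K₂ⱼ = ⟨x₂ⱼ₋₁ ^ β * x₂ⱼ ^ (-α) : x ∈ X⟩` for `1 ≤ j ≤ m`. The indices in the code
are those of this description minus one. -/
def twistedDecomposition {H : Type*} [Group H] (X : Set H) {p : ℕ} (α β : ZMod p) (n m : ℕ) :
    Set (Subgroup (CentralPower H (2 * n))) :=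
  {L | ∃ (j : ℕ) (_ : j < m) (hj : j < n),
      L = twistedSubgroup X (⟨2 * j, by omega⟩ : Fin (2 * n)) ⟨2 * j + 1, by omega⟩ α β ∨
      L = twistedSubgroup X (⟨2 * j, by omega⟩ : Fin (2 * n)) ⟨2 * j + 1, by omega⟩ β (-α)} ∪
  {L | ∃ i : Fin (2 * n), 2 * m ≤ (i : ℕ) ∧ L = componentSubgroup X i}

/-- The relators of the presentation `⟨x, y, z ∣ class 2, exponent p⟩`: all `p`-th powers and all
triple commutators. -/
def classTwoExpRels (p : ℕ) : Set (FreeGroup (Fin 3)) :=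
  {r | ∃ g : FreeGroup (Fin 3), r = g ^ p} ∪ {r | ∃ g₁ g₂ g₃ : FreeGroup (Fin 3), r = ⁅⁅g₁, g₂⁆, g₃⁆}

/-- The group `⟨x, y, z ∣ class 2, exponent p⟩`. -/
abbrev FreeClassTwo (p : ℕ) : Type := PresentedGroup (classTwoExpRels p)

/-- The set `{x, y, z}` of the three defining generators. -/
def FreeClassTwo.gens (p : ℕ) : Set (FreeClassTwo p) :=
  Set.range (PresentedGroup.of (rels := classTwoExpRels p))

/-- The orbits of a group `A` of automorphisms of `P` on the set of fully refined central
decompositions of `P`, where `φ • 𝓚 = {φ(K) : K ∈ 𝓚}`. -/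
def fullyRefinedOrbits {P : Type*} [Group P] (A : Subgroup (MulAut P)) :
    Set (Set (Set (Subgroup P))) :=
  {O | ∃ 𝓚 : Set (Subgroup P), IsFullyRefined 𝓚 ∧ O = MulAction.orbit A 𝓚}

/-- `C_{Aut P}(P')`: the automorphisms of `P` that fix every element of `P'`. -/
def autCentralizingDerived (P : Type*) [Group P] : Subgroup (MulAut P) :=
  fixingSubgroup (MulAut P) (commutator P : Set P)

/-- The `2n`-fold canonical central product of `⟨x, y, z ∣ class 2, exponent p⟩`. -/
abbrev FreeClassTwoPower (p n : ℕ) : Type := CentralPower (FreeClassTwo p) (2 * n)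

/-- The set `𝓗ₘ` for `H = ⟨x, y, z ∣ class 2, exponent p⟩` and `X = {x, y, z}`. -/
def decompositionH {p : ℕ} (α β : ZMod p) (n m : ℕ) : Set (Subgroup (FreeClassTwoPower p n)) :=
  twistedDecomposition (FreeClassTwo.gens p) α β n m

/-! Write `F = ZMod p`. As `2` is invertible, `H` is the group on `F³ × F³` with product `(u, w)(u',
w') = (u + u', w + w' + u ⨯₃ u')`. Then `P` is the analogous group on `(F^{2n} ⊗ F³) × F³`, whose
form sends `(a ⊗ u, c ⊗ v)` to `(a ⬝ᵥ c) (u ⨯₃ v)` (`freeEquiv`, `powerEquiv`).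

Fully refined central decompositions of `P` are the orthogonal bases of `F^{2n}` up to order and
scaling: a basis vector `a` gives the full preimage of `a ⊗ F³`, a copy of `H`
(`IsFrame.isFullyRefined`, `exists_isFrame`). For the converse, the projection onto a summand of an
orthogonal decomposition is self-adjoint, and the cross product on `F³` has so few self-adjoint maps
that the projection acts on `F^{2n}` alone (`exists_tens_mem`).

Scaling multiplies `a ⬝ᵥ a` by a square, so the number of basis vectors of nonsquare norm is an
invariant of the frame. It is even, because the product of the norms is the square of a determinant.
Frames with equal counts are, after scaling and reordering, related by an isometry, which acts
trivially on the centre of `P` (`exists_aut_of_nonsquareCount_eq`).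

An automorphism inducing `θ` on the centre and taking the line of `a` to the line of `c` satisfies
`(c ⬝ᵥ c)³ (det g)² = (a ⬝ᵥ a)³ det θ` for some `g` (`cube_det_eq`). Hence it changes the quadratic
character of all norms by the same sign: the count is kept or complemented, and it is kept when `P'`
is fixed, as then `θ = 1`. Complementation does occur, through a similitude of multiplier `α² + β²`.
The decomposition with parameter `m` has count `2m`. -/

set_option linter.unusedSectionVars false

/-! ### Transport of decompositions along isomorphisms. -/

section Transport

variable {G G' : Type*} [Group G] [Group G']

theorem IsCentralDecomposition.map {𝓗 : Set (Subgroup G)} (h : IsCentralDecomposition 𝓗)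
    (e : G ≃* G') : IsCentralDecomposition (e.mapSubgroup '' 𝓗) := by
  obtain ⟨hc, hs, hm⟩ := h
  refine ⟨?_, ?_, ?_⟩
  · rintro _ ⟨H, hH, rfl⟩ _ ⟨K, hK, rfl⟩ hne x hx y hy
    obtain ⟨x, hx, rfl⟩ := hx
    obtain ⟨y, hy, rfl⟩ := hy
    exact (hc H hH K hK (fun h => hne (h ▸ rfl)) x hx y hy).map e
  · rw [sSup_image, ← OrderIso.map_sSup, hs, map_top]
  · intro 𝓙 hJ htop
    refine hm (e.mapSubgroup ⁻¹' 𝓙) ?_ ?_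
    · have := (Set.preimage_mono hJ.1 : e.mapSubgroup ⁻¹' 𝓙 ⊆ e.mapSubgroup ⁻¹' _)
      rw [Set.preimage_image_eq _ e.mapSubgroup.injective] at this
      refine ⟨this, fun h => hJ.2 ?_⟩
      rintro _ ⟨H, hH, rfl⟩
      exact h hH
    · apply e.mapSubgroup.injective
      rw [OrderIso.map_sSup, map_top, ← sSup_image,
        Set.image_preimage_eq _ e.mapSubgroup.surjective, htop]

/-- By minimality, since `{⊤}` already generates. Indecomposability is always proved by exhibiting
`⊤` as a member. -/
theorem IsCentralDecomposition.eq_singleton_top {𝓗 : Set (Subgroup G)}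
    (h : IsCentralDecomposition 𝓗) (ht : ⊤ ∈ 𝓗) : 𝓗 = {⊤} := by
  by_contra hne
  exact h.2.2 {⊤} ((Set.singleton_subset_iff.2 ht).ssubset_of_ne (Ne.symm hne)) sSup_singleton

theorem IsCentrallyIndecomposable.of_equiv (h : IsCentrallyIndecomposable G) (e : G ≃* G') :
    IsCentrallyIndecomposable G' := by
  intro 𝓗 h𝓗
  have h1 := h _ (h𝓗.map e.symm)
  have h2 : (⊤ : Subgroup G) ∈ e.symm.mapSubgroup '' 𝓗 := h1 ▸ rfl
  obtain ⟨H, hH, hHt⟩ := h2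
  have : H = ⊤ := e.symm.mapSubgroup.injective (hHt.trans (map_top _).symm)
  exact h𝓗.eq_singleton_top (this ▸ hH)

theorem IsFullyRefined.map {𝓗 : Set (Subgroup G)} (h : IsFullyRefined 𝓗) (e : G ≃* G') :
    IsFullyRefined (e.mapSubgroup '' 𝓗) := by
  refine ⟨h.1.map e, ?_⟩
  rintro _ ⟨H, hH, rfl⟩
  exact (h.2 H hH).of_equiv (e.subgroupMap H)

theorem MulAut.smul_eq_image_mapSubgroup (φ : MulAut G) (𝓗 : Set (Subgroup G)) :
    φ • 𝓗 = MulEquiv.mapSubgroup φ '' 𝓗 := by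
  rw [← Set.image_smul]
  rfl

theorem MulAut.congr_smul_image (e : G ≃* G') (φ : MulAut G) (𝓗 : Set (Subgroup G)) :
    MulAut.congr e φ • (e.mapSubgroup '' 𝓗) = e.mapSubgroup '' (φ • 𝓗) := by
  rw [MulAut.smul_eq_image_mapSubgroup, MulAut.smul_eq_image_mapSubgroup, Set.image_image,
    Set.image_image]
  refine Set.image_congr fun H _ => ?_
  ext x
  simp only [MulEquiv.mapSubgroup_apply, Subgroup.mem_map, MonoidHom.coe_coe]
  constructor
  · rintro ⟨_, ⟨y, hy, rfl⟩, rfl⟩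
    exact ⟨φ y, ⟨y, hy, rfl⟩, by simp [MulAut.congr]⟩
  · rintro ⟨_, ⟨y, hy, rfl⟩, rfl⟩
    exact ⟨e y, ⟨y, hy, rfl⟩, by simp [MulAut.congr]⟩

theorem mem_autCentralizingDerived_iff {φ : MulAut G} :
    φ ∈ autCentralizingDerived G ↔ ∀ x ∈ commutator G, φ x = x := by
  simp [autCentralizingDerived, mem_fixingSubgroup_iff]

theorem congr_mem_autCentralizingDerived (e : G ≃* G') {φ : MulAut G}
    (h : φ ∈ autCentralizingDerived G) : MulAut.congr e φ ∈ autCentralizingDerived G' := by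
  rw [mem_autCentralizingDerived_iff] at h ⊢
  intro x hx
  have hx' : e.symm x ∈ commutator G := by
    have := Subgroup.mem_map_of_mem (e.symm : G' →* G) hx
    rw [commutator_def, Subgroup.map_commutator] at this
    exact Subgroup.commutator_mono le_top le_top this
  change e (φ (e.symm x)) = x
  rw [h _ hx', e.apply_symm_apply]

end Transport

/-! ### Class-two groups defined by bilinear maps. -/

/-- The group on `V × W` with multiplication `(v, w) (v', w') = (v + v', w + w' + β v v')`. -/
@[ext]
structure BaerGroup {F V W : Type*} [CommRing F] [AddCommGroup V] [Module F V] [AddCommGroup W]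
    [Module F W] (β : V →ₗ[F] V →ₗ[F] W) where
  /-- The component in `V`. -/
  vec : V
  /-- The component in `W`. -/
  ctr : W

namespace BaerGroup

section Group

variable {F V W : Type*} [CommRing F] [AddCommGroup V] [Module F V] [AddCommGroup W]
  [Module F W] {β : V →ₗ[F] V →ₗ[F] W}

instance : Group (BaerGroup β) where
  mul x y := ⟨x.vec + y.vec, x.ctr + y.ctr + β x.vec y.vec⟩
  one := ⟨0, 0⟩
  inv x := ⟨-x.vec, -x.ctr + β x.vec x.vec⟩
  mul_assoc x y z := by
    change (⟨_, _⟩ : BaerGroup β) = ⟨_, _⟩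
    congr 1
    · exact add_assoc _ _ _
    · change x.ctr + y.ctr + β x.vec y.vec + z.ctr + β (x.vec + y.vec) z.vec =
        x.ctr + (y.ctr + z.ctr + β y.vec z.vec) + β x.vec (y.vec + z.vec)
      simp only [map_add, LinearMap.add_apply]
      abel
  one_mul x := by
    change (⟨0 + x.vec, 0 + x.ctr + β 0 x.vec⟩ : BaerGroup β) = x
    simp
  mul_one x := by
    change (⟨x.vec + 0, x.ctr + 0 + β x.vec 0⟩ : BaerGroup β) = x
    simp
  inv_mul_cancel x := by
    change (⟨-x.vec + x.vec, -x.ctr + β x.vec x.vec + x.ctr + β (-x.vec) x.vec⟩ : BaerGroup β)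
      = ⟨0, 0⟩
    simp

@[simp] theorem vec_mul (x y : BaerGroup β) : (x * y).vec = x.vec + y.vec := rfl
@[simp] theorem ctr_mul (x y : BaerGroup β) :
    (x * y).ctr = x.ctr + y.ctr + β x.vec y.vec := rfl
@[simp] theorem vec_one : (1 : BaerGroup β).vec = 0 := rfl
@[simp] theorem ctr_one : (1 : BaerGroup β).ctr = 0 := rfl
@[simp] theorem vec_inv (x : BaerGroup β) : (x⁻¹).vec = -x.vec := rfl
@[simp] theorem ctr_inv (x : BaerGroup β) : (x⁻¹).ctr = -x.ctr + β x.vec x.vec := rfl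

variable (β) in
/-- The projection onto `V`. -/
def vecHom : BaerGroup β →* Multiplicative V where
  toFun x := Multiplicative.ofAdd x.vec
  map_one' := rfl
  map_mul' _ _ := rfl

@[simp] theorem vec_pow (x : BaerGroup β) (k : ℕ) : (x ^ k).vec = k • x.vec :=
  congrArg Multiplicative.toAdd (map_pow (vecHom β) x k)

theorem ctr_pow (hβ : β.IsAlt) (x : BaerGroup β) (k : ℕ) : (x ^ k).ctr = k • x.ctr := by
  induction k with
  | zero => simp
  | succ k ih => simp [pow_succ, ih, hβ.self_eq_zero, add_smul]

theorem commute_iff {x y : BaerGroup β} : Commute x y ↔ β x.vec y.vec = β y.vec x.vec := by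
  rw [commute_iff_eq, BaerGroup.ext_iff]
  simp [add_comm]

theorem commutatorElement_eq (hβ : β.IsAlt) (x y : BaerGroup β) :
    ⁅x, y⁆ = ⟨0, (2 : F) • β x.vec y.vec⟩ := by
  rw [commutatorElement_def]
  ext
  · simp
  · simp [hβ.self_eq_zero, two_smul, ← hβ.neg y.vec x.vec]
    abel

/-- Elements of the form `(0, w)` multiply by addition. -/
def ctrHom : Multiplicative W →* BaerGroup β where
  toFun w := ⟨0, w.toAdd⟩
  map_one' := rfl
  map_mul' _ _ := by ext <;> simp

theorem vec_eq_zero_of_mem_commutator {x : BaerGroup β} (hx : x ∈ commutator (BaerGroup β)) :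
    x.vec = 0 :=
  Multiplicative.ofAdd.injective (Abelianization.commutator_subset_ker (vecHom β) hx)

variable {V' W' : Type*} [AddCommGroup V'] [Module F V'] [AddCommGroup W'] [Module F W']
  {β' : V' →ₗ[F] V' →ₗ[F] W'}

/-- The homomorphism induced by a pair of linear maps compatible with the bilinear maps. -/
def map (f : V →ₗ[F] V') (θ : W →ₗ[F] W') (h : ∀ x y, β' (f x) (f y) = θ (β x y)) :
    BaerGroup β →* BaerGroup β' where
  toFun x := ⟨f x.vec, θ x.ctr⟩
  map_one' := by ext <;> simp
  map_mul' x y := by ext <;> simp [h]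

/-- The isomorphism induced by a pair of linear equivalences compatible with the bilinear maps. -/
def mapEquiv (f : V ≃ₗ[F] V') (θ : W ≃ₗ[F] W') (h : ∀ x y, β' (f x) (f y) = θ (β x y)) :
    BaerGroup β ≃* BaerGroup β' where
  toFun x := ⟨f x.vec, θ x.ctr⟩
  invFun x := ⟨f.symm x.vec, θ.symm x.ctr⟩
  left_inv x := by simp
  right_inv x := by simp
  map_mul' x y := by ext <;> simp [h]

end Group

section ZMod

variable {p : ℕ} [Fact p.Prime] {V W : Type*} [AddCommGroup V] [Module (ZMod p) V]
  [AddCommGroup W] [Module (ZMod p) W] {β : V →ₗ[ZMod p] V →ₗ[ZMod p] W}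

theorem commute_iff_of_isAlt [NeZero (2 : ZMod p)] (hβ : β.IsAlt) {x y : BaerGroup β} :
    Commute x y ↔ β x.vec y.vec = 0 := by
  rw [commute_iff, ← hβ.neg x.vec y.vec]
  constructor
  · intro h
    have h2 : (2 : ZMod p) • β x.vec y.vec = 0 := by
      rw [two_smul]; nth_rewrite 2 [h]; simp
    exact (smul_eq_zero.1 h2).resolve_left (NeZero.ne _)
  · intro h; simp [h]

/-- The image in `V` of a subgroup. -/
def vecSub (K : Subgroup (BaerGroup β)) : Submodule (ZMod p) V :=
  AddSubgroup.toZModSubmodule p (Subgroup.toAddSubgroup' (K.map (vecHom β)))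

/-- The intersection of a subgroup with `W`. -/
def ctrSub (K : Subgroup (BaerGroup β)) : Submodule (ZMod p) W :=
  AddSubgroup.toZModSubmodule p (Subgroup.toAddSubgroup' (K.comap ctrHom))

theorem mem_ctrSub {K : Subgroup (BaerGroup β)} {w : W} :
    w ∈ ctrSub K ↔ (⟨0, w⟩ : BaerGroup β) ∈ K := Iff.rfl

theorem vecSub_mono {K L : Subgroup (BaerGroup β)} (h : K ≤ L) : vecSub K ≤ vecSub L := by
  rintro _ ⟨x, hx, rfl⟩
  exact ⟨x, h hx, rfl⟩

/-- The commutator of lifts of `v` and `v'` is `2 β v v'`, and `2` is invertible. -/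
theorem apply_mem_ctrSub [NeZero (2 : ZMod p)] (hβ : β.IsAlt) {K : Subgroup (BaerGroup β)}
    {v v' : V} (hv : v ∈ vecSub K) (hv' : v' ∈ vecSub K) : β v v' ∈ ctrSub K := by
  obtain ⟨x, hx, rfl⟩ := hv
  obtain ⟨y, hy, rfl⟩ := hv'
  have h : (2 : ZMod p) • β x.vec y.vec ∈ ctrSub K := by
    rw [mem_ctrSub, ← commutatorElement_eq hβ, commutatorElement_def]
    exact mul_mem (mul_mem (mul_mem hx hy) (inv_mem hx)) (inv_mem hy)
  have h' := (ctrSub K).smul_mem (2 : ZMod p)⁻¹ h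
  rwa [smul_smul, inv_mul_cancel₀ (NeZero.ne _), one_smul] at h'

theorem mem_of_ctrSub_eq_top {K : Subgroup (BaerGroup β)} (h : ctrSub K = ⊤) {x : BaerGroup β}
    (hx : x.vec ∈ vecSub K) : x ∈ K := by
  obtain ⟨y, hy, hyx : y.vec = x.vec⟩ := hx
  have : x = y * ⟨0, x.ctr - y.ctr⟩ := by
    ext
    · simpa using hyx.symm
    · simp
  rw [this]
  exact mul_mem hy (mem_ctrSub.1 (h ▸ Submodule.mem_top))

theorem eq_top_of_vecSub_eq_top {K : Subgroup (BaerGroup β)} (h : ctrSub K = ⊤)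
    (h' : vecSub K = ⊤) : K = ⊤ :=
  (Subgroup.eq_top_iff' K).2 fun _ => mem_of_ctrSub_eq_top h (h' ▸ Submodule.mem_top)

end ZMod

end BaerGroup

/-! ### The free class-two group of rank three as the cross product group. -/

theorem Subgroup.exists_zpow_of_mem_closure_triple {G : Type*} [Group G] {x y z g : G}
    (hxy : Commute x y) (hxz : Commute x z) (hyz : Commute y z)
    (hg : g ∈ Subgroup.closure {x, y, z}) : ∃ a b c : ℤ, g = x ^ a * y ^ b * z ^ c := by
  have key : ∀ s ∈ ({x, y, z} : Set G), ∀ k : ℤ, ∀ g : G, (∃ a b c : ℤ, g = x ^ a * y ^ b * z ^ c) →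
      ∃ a b c : ℤ, g * s ^ k = x ^ a * y ^ b * z ^ c := by
    rintro s (rfl | rfl | rfl) k _ ⟨a, b, c, rfl⟩
    · refine ⟨a + k, b, c, ?_⟩
      rw [mul_assoc, (hxz.symm.zpow_zpow c k).eq, ← mul_assoc, mul_assoc (s ^ a),
        (hxy.symm.zpow_zpow b k).eq, ← mul_assoc, zpow_add]
    · refine ⟨a, b + k, c, ?_⟩
      rw [mul_assoc, (hyz.symm.zpow_zpow c k).eq, ← mul_assoc, zpow_add, ← mul_assoc]
    · exact ⟨a, b, c + k, by rw [mul_assoc, ← zpow_add]⟩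
  induction hg using Subgroup.closure_induction_right with
  | one => exact ⟨0, 0, 0, by simp⟩
  | mul_right x _ y hy h => simpa using key y hy 1 x h
  | mul_inv_cancel x _ y hy h => simpa using key y hy (-1) x h

namespace Heisenberg

open Matrix

theorem isAlt_crossProduct {F : Type*} [CommRing F] :
    (crossProduct : (Fin 3 → F) →ₗ[F] (Fin 3 → F) →ₗ[F] Fin 3 → F).IsAlt :=
  fun v => cross_self v

variable (p : ℕ)

/-- The group on `𝔽ₚ³ × 𝔽ₚ³` defined by the cross product. -/
abbrev Heis : Type := BaerGroup (crossProduct (R := ZMod p))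

variable {p}

/-- The standard generators. -/
def gen (i : Fin 3) : Heis p := ⟨Pi.single i 1, 0⟩

theorem eq_zero_of_cross_right {u : Fin 3 → ZMod p} (h : ∀ v, u ⨯₃ v = 0) : u = 0 := by
  have h0 := h ![1, 0, 0]
  have h1 := h ![0, 1, 0]
  rw [cross_apply] at h0 h1
  have h01 := congrFun h0 1
  have h02 := congrFun h0 2
  have h10 := congrFun h1 2
  ext i
  fin_cases i <;> simp_all

section

variable [Fact p.Prime]

theorem span_cross_eq_top {S : Submodule (ZMod p) (Fin 3 → ZMod p)}
    (h : ∀ u v, u ⨯₃ v ∈ S) : S = ⊤ := by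
  rw [Submodule.eq_top_iff']
  intro w
  have : w = w 2 • (![1, 0, 0] ⨯₃ ![0, 1, 0]) + w 0 • (![0, 1, 0] ⨯₃ ![0, 0, 1])
      + w 1 • (![0, 0, 1] ⨯₃ ![1, 0, 0]) := by
    ext i
    fin_cases i <;> simp [cross_apply]
  rw [this]
  exact add_mem (add_mem (S.smul_mem _ (h _ _)) (S.smul_mem _ (h _ _))) (S.smul_mem _ (h _ _))

variable [NeZero (2 : ZMod p)]

/-- A subgroup that is everything modulo the centre contains all commutators, and cross products
span the centre. -/
theorem eq_top_of_vecSub_eq_top {K : Subgroup (Heis p)} (h : BaerGroup.vecSub K = ⊤) : K = ⊤ :=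
  BaerGroup.eq_top_of_vecSub_eq_top (span_cross_eq_top fun _ _ =>
    BaerGroup.apply_mem_ctrSub isAlt_crossProduct (h ▸ Submodule.mem_top)
      (h ▸ Submodule.mem_top)) h

theorem closure_range_gen : Subgroup.closure (Set.range (gen (p := p))) = ⊤ := by
  refine eq_top_of_vecSub_eq_top ?_
  rw [Submodule.eq_top_iff']
  intro v
  rw [pi_eq_sum_univ' v]
  exact Submodule.sum_mem _ fun i _ => Submodule.smul_mem _ _
    ⟨gen i, Subgroup.subset_closure ⟨i, rfl⟩, rfl⟩

end

theorem lift_gen_eq_one (r) (hr : r ∈ classTwoExpRels p) :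
    FreeGroup.lift (gen (p := p)) r = 1 := by
  rcases hr with ⟨g, rfl⟩ | ⟨g₁, g₂, g₃, rfl⟩
  · rw [map_pow]
    ext : 1
    · rw [BaerGroup.vec_pow]
      simp
    · rw [BaerGroup.ctr_pow isAlt_crossProduct]
      simp
  · rw [map_commutatorElement, map_commutatorElement,
      BaerGroup.commutatorElement_eq isAlt_crossProduct,
      BaerGroup.commutatorElement_eq isAlt_crossProduct]
    ext : 1 <;> simp

/-- The canonical homomorphism from the presented group. -/
def ofFree (p : ℕ) : FreeClassTwo p →* Heis p := PresentedGroup.toGroup lift_gen_eq_one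

@[simp] theorem ofFree_of (i : Fin 3) : ofFree p (PresentedGroup.of i) = gen i :=
  PresentedGroup.toGroup.of _

end Heisenberg

theorem FreeClassTwo.pow_eq_one {p : ℕ} (g : FreeClassTwo p) : g ^ p = 1 := by
  obtain ⟨g, rfl⟩ := PresentedGroup.mk_surjective _ g
  rw [← map_pow]
  exact PresentedGroup.one_of_mem (Or.inl ⟨g, rfl⟩)

theorem FreeClassTwo.commute_commutatorElement {p : ℕ} (g h k : FreeClassTwo p) :
    Commute ⁅g, h⁆ k := by
  obtain ⟨g, rfl⟩ := PresentedGroup.mk_surjective _ g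
  obtain ⟨h, rfl⟩ := PresentedGroup.mk_surjective _ h
  obtain ⟨k, rfl⟩ := PresentedGroup.mk_surjective _ k
  rw [← commutatorElement_eq_one_iff_commute, ← map_commutatorElement, ← map_commutatorElement]
  exact PresentedGroup.one_of_mem (Or.inr ⟨g, h, k, rfl⟩)

theorem FreeClassTwo.zpow_eq_one {p : ℕ} (g : FreeClassTwo p) {a : ℤ} (h : (a : ZMod p) = 0) :
    g ^ a = 1 := by
  obtain ⟨k, rfl⟩ := (ZMod.intCast_zmod_eq_zero_iff_dvd _ _).1 h
  rw [zpow_mul, zpow_natCast, pow_eq_one, one_zpow]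

/-- Every element of the free class two group has a normal form. -/
theorem FreeClassTwo.exists_normal_form {p : ℕ} (g : FreeClassTwo p) :
    ∃ a b c d e f : ℤ, ∀ x y z : FreeClassTwo p, x = PresentedGroup.of 0 →
      y = PresentedGroup.of 1 → z = PresentedGroup.of 2 →
      g = x ^ a * y ^ b * z ^ c * (⁅x, y⁆ ^ d * ⁅y, z⁆ ^ e * ⁅z, x⁆ ^ f) := by
  obtain ⟨x, hx⟩ : ∃ x : FreeClassTwo p, x = PresentedGroup.of 0 := ⟨_, rfl⟩
  obtain ⟨y, hy⟩ : ∃ x : FreeClassTwo p, x = PresentedGroup.of 1 := ⟨_, rfl⟩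
  obtain ⟨z, hz⟩ : ∃ x : FreeClassTwo p, x = PresentedGroup.of 2 := ⟨_, rfl⟩
  suffices ∃ a b c d e f : ℤ,
      g = x ^ a * y ^ b * z ^ c * (⁅x, y⁆ ^ d * ⁅y, z⁆ ^ e * ⁅z, x⁆ ^ f) by
    obtain ⟨a, b, c, d, e, f, h⟩ := this
    refine ⟨a, b, c, d, e, f, ?_⟩
    rintro x' y' z' rfl rfl rfl
    rw [← hx, ← hy, ← hz]
    exact h
  -- The three basic commutators are central and the generators commute modulo `C`, so the normal
  -- form is found first modulo `C` and then inside `C`.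
  set C : Subgroup (FreeClassTwo p) := Subgroup.closure {⁅x, y⁆, ⁅y, z⁆, ⁅z, x⁆} with hC
  have hCc : C ≤ Subgroup.center _ := by
    rw [hC, Subgroup.closure_le]
    rintro _ (rfl | rfl | rfl) <;>
    exact Subgroup.mem_center_iff.2 fun k => (commute_commutatorElement _ _ k).symm.eq
  have : C.Normal := ⟨fun a ha b => by
    rw [Subgroup.mem_center_iff.1 (hCc ha) b, mul_inv_cancel_right]; exact ha⟩
  have hcom : ∀ a b : FreeClassTwo p, ⁅a, b⁆ ∈ C →
      Commute (QuotientGroup.mk' C a) (QuotientGroup.mk' C b) := fun a b h => by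
    rw [← commutatorElement_eq_one_iff_commute, ← map_commutatorElement]
    exact (QuotientGroup.eq_one_iff _).2 h
  have htop : Subgroup.closure ({x, y, z} : Set (FreeClassTwo p)) = ⊤ := by
    rw [← PresentedGroup.closure_range_of]
    congr 1
    ext w
    simp [Fin.exists_fin_succ, hx, hy, hz, eq_comm]
  have hg : QuotientGroup.mk' C g ∈ Subgroup.closure
      ({QuotientGroup.mk' C x, QuotientGroup.mk' C y, QuotientGroup.mk' C z}) := by
    have := Subgroup.mem_map_of_mem (QuotientGroup.mk' C) (htop ▸ Subgroup.mem_top g)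
    rwa [MonoidHom.map_closure, Set.image_insert_eq, Set.image_pair] at this
  obtain ⟨a, b, c, habc⟩ := Subgroup.exists_zpow_of_mem_closure_triple
    (hcom _ _ (Subgroup.subset_closure (by simp)))
    (hcom _ _ (by rw [← commutatorElement_inv]
                  exact inv_mem (Subgroup.subset_closure (by simp))))
    (hcom _ _ (Subgroup.subset_closure (by simp))) hg
  rw [← map_zpow, ← map_zpow, ← map_zpow, ← map_mul, ← map_mul] at habc
  have hmem : (x ^ a * y ^ b * z ^ c)⁻¹ * g ∈ C := QuotientGroup.eq.1 habc.symm
  obtain ⟨d, e, f, hdef⟩ := Subgroup.exists_zpow_of_mem_closure_triple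
    (commute_commutatorElement _ _ _) (commute_commutatorElement _ _ _)
    (commute_commutatorElement _ _ _) hmem
  exact ⟨a, b, c, d, e, f, by rw [← hdef, mul_inv_cancel_left]⟩

namespace Heisenberg

open Matrix

variable {p : ℕ} [Fact p.Prime] [NeZero (2 : ZMod p)]

theorem ofFree_surjective : Function.Surjective (ofFree p) := by
  rw [← MonoidHom.range_eq_top, eq_top_iff, ← closure_range_gen, Subgroup.closure_le]
  rintro _ ⟨i, rfl⟩
  exact ⟨_, ofFree_of i⟩

theorem ofFree_injective : Function.Injective (ofFree p) := by
  rw [injective_iff_map_eq_one]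
  intro g hg
  obtain ⟨a, b, c, d, e, f, h⟩ := FreeClassTwo.exists_normal_form g
  obtain h := h _ _ _ rfl rfl rfl
  have hcomm : ∀ i j : Fin 3, ofFree p ⁅PresentedGroup.of i, PresentedGroup.of j⁆ =
      BaerGroup.ctrHom (Multiplicative.ofAdd
        ((2 : ZMod p) • (Pi.single i 1 ⨯₃ Pi.single j (1 : ZMod p)))) := fun i j => by
    rw [map_commutatorElement, BaerGroup.commutatorElement_eq isAlt_crossProduct]
    simp [BaerGroup.ctrHom, gen]
  have hz : ∀ (i : Fin 3) (k : ℤ), (gen (p := p) i ^ k).vec = k • Pi.single i 1 := fun i k =>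
    congrArg Multiplicative.toAdd (map_zpow (BaerGroup.vecHom _) (gen (p := p) i) k)
  have hc0 : ∀ w, (BaerGroup.ctrHom (β := crossProduct (R := ZMod p)) w).vec = 0 := fun _ => rfl
  have hc1 : ∀ w, (BaerGroup.ctrHom (β := crossProduct (R := ZMod p)) w).ctr = w.toAdd :=
    fun _ => rfl
  have hv : (ofFree p g).vec = 0 := by rw [hg]; rfl
  rw [h] at hv
  simp only [map_mul, map_zpow, hcomm, ofFree_of, BaerGroup.vec_mul, hz] at hv
  simp only [← map_zpow, hc0, add_zero] at hv
  -- The exponents of the generators are the coordinates of the vector part, so an element of the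
  -- kernel has these divisible by `p`.
  have ha : (a : ZMod p) = 0 := by simpa using congrFun hv 0
  have hb : (b : ZMod p) = 0 := by simpa using congrFun hv 1
  have hc : (c : ZMod p) = 0 := by simpa using congrFun hv 2
  rw [FreeClassTwo.zpow_eq_one _ ha, FreeClassTwo.zpow_eq_one _ hb,
    FreeClassTwo.zpow_eq_one _ hc, one_mul, one_mul, one_mul] at h
  have hw : (ofFree p g).ctr = 0 := by rw [hg]; rfl
  rw [h] at hw
  simp only [map_mul, map_zpow, hcomm] at hw
  simp only [← map_zpow, ← map_mul, hc1, toAdd_mul, toAdd_zpow, toAdd_ofAdd] at hw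
  have h2 : (2 : ZMod p) ≠ 0 := NeZero.ne _
  -- Only commutators remain; their exponents are half the central coordinates, cyclically shifted
  -- because `⁅x, y⁆` lies over the third axis.
  have hd : (d : ZMod p) = 0 := by simpa [cross_apply, h2] using congrFun hw 2
  have he : (e : ZMod p) = 0 := by simpa [cross_apply, h2] using congrFun hw 0
  have hf : (f : ZMod p) = 0 := by simpa [cross_apply, h2] using congrFun hw 1
  rw [h, FreeClassTwo.zpow_eq_one _ hd, FreeClassTwo.zpow_eq_one _ he,
    FreeClassTwo.zpow_eq_one _ hf, one_mul, one_mul]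

/-- The presented group is the group defined by the cross product. -/
noncomputable def freeEquiv (p : ℕ) [Fact p.Prime] [NeZero (2 : ZMod p)] :
    FreeClassTwo p ≃* Heis p :=
  MulEquiv.ofBijective (ofFree p) ⟨ofFree_injective, ofFree_surjective⟩

@[simp] theorem freeEquiv_of (i : Fin 3) : freeEquiv p (PresentedGroup.of i) = gen i :=
  ofFree_of i

/-- In `𝔽ₚ³` only `0` is parallel to two independent vectors. -/
theorem eq_zero_of_cross_eq_zero {u v x : Fin 3 → ZMod p} (huv : u ⨯₃ v ≠ 0)
    (hu : u ⨯₃ x = 0) (hv : v ⨯₃ x = 0) : x = 0 := by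
  by_contra hx
  have key : ∀ {a b : Fin 3 → ZMod p}, a ⨯₃ x = 0 → b ⨯₃ x = 0 → a ⨯₃ b = 0 := by
    intro a b ha hb
    obtain ⟨i, hi⟩ := Function.ne_iff.1 hx
    have ha0 := congrFun ha 0; have ha1 := congrFun ha 1; have ha2 := congrFun ha 2
    have hb0 := congrFun hb 0; have hb1 := congrFun hb 1; have hb2 := congrFun hb 2
    simp only [cross_apply, Matrix.cons_val, Pi.zero_apply] at ha0 ha1 ha2 hb0 hb1 hb2
    ext j
    refine (mul_eq_zero.1 (?_ : x i * _ = 0)).resolve_left hi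
    fin_cases i <;> fin_cases j <;> simp [cross_apply] <;> grind
  exact huv (key hu hv)

/-- Some member `H` contains noncommuting `x` and `y`, since an element commuting with every member
is central. Elements of other members commute with both, so they are parallel to two independent
vectors and hence central. Thus `H` alone covers the quotient by the centre, and its commutators
supply the centre. -/
theorem isCentrallyIndecomposable (p : ℕ) [Fact p.Prime] [NeZero (2 : ZMod p)] :
    IsCentrallyIndecomposable (Heis p) := by
  intro 𝓗 h
  obtain ⟨hc, hs, -⟩ := id h
  have hc' : ∀ H ∈ 𝓗, ∀ K ∈ 𝓗, H ≠ K → ∀ x ∈ H, ∀ y ∈ K, x.vec ⨯₃ y.vec = 0 :=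
    fun H hH K hK hne x hx y hy =>
      (BaerGroup.commute_iff_of_isAlt isAlt_crossProduct).1 (hc H hH K hK hne x hx y hy)
  have line : ∀ u : Fin 3 → ZMod p, (∀ H ∈ 𝓗, ∀ x ∈ H, u ⨯₃ x.vec = 0) → u = 0 := by
    intro u hu
    let L : Subgroup (Heis p) := MonoidHom.ker
      ((AddMonoidHom.toMultiplicative (crossProduct u).toAddMonoidHom).comp (BaerGroup.vecHom _))
    have hL : (⊤ : Subgroup (Heis p)) ≤ L := hs ▸ sSup_le fun H hH x hx => hu H hH x hx
    exact eq_zero_of_cross_right fun v => hL (Subgroup.mem_top (⟨v, 0⟩ : Heis p))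
  obtain ⟨H, hH, x, hx, hx0⟩ : ∃ H ∈ 𝓗, ∃ x ∈ H, x.vec ≠ 0 := by
    by_contra! hcon
    have := congrFun (line ![1, 0, 0] fun H hH x hx => by simp [hcon H hH x hx]) 0
    simp at this
  obtain ⟨y, hy, hxy⟩ : ∃ y ∈ H, x.vec ⨯₃ y.vec ≠ 0 := by
    by_contra! hcon
    refine hx0 (line _ fun K hK y hy => ?_)
    by_cases hKH : H = K
    · exact hcon y (hKH ▸ hy)
    · exact hc' H hH K hK hKH x hx y hy
  have hother : ∀ K ∈ 𝓗, K ≠ H → ∀ z ∈ K, z.vec = 0 := fun K hK hne z hz =>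
    eq_zero_of_cross_eq_zero hxy (hc' H hH K hK hne.symm x hx z hz)
      (hc' H hH K hK hne.symm y hy z hz)
  have hvec : BaerGroup.vecSub H = ⊤ := by
    let L : Subgroup (Heis p) :=
      (AddSubgroup.toSubgroup (BaerGroup.vecSub H).toAddSubgroup).comap (BaerGroup.vecHom _)
    have hL : (⊤ : Subgroup (Heis p)) ≤ L := hs ▸ sSup_le fun K hK z hz => by
      change z.vec ∈ BaerGroup.vecSub H
      by_cases hKH : K = H
      · exact ⟨z, hKH ▸ hz, rfl⟩
      · rw [hother K hK hKH z hz]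
        exact zero_mem _
    rw [Submodule.eq_top_iff']
    exact fun v => hL (Subgroup.mem_top (⟨v, 0⟩ : Heis p))
  exact h.eq_singleton_top (eq_top_of_vecSub_eq_top hvec ▸ hH)

end Heisenberg

/-! ### The model of the central power: the form on `F^ι ⊗ F³`. -/

namespace Heisenberg

open Matrix

section Form

variable (p : ℕ) (ι : Type*) [Fintype ι]

/-- The sum of the cross products of the components. -/
def sumCross : (ι → Fin 3 → ZMod p) →ₗ[ZMod p] (ι → Fin 3 → ZMod p) →ₗ[ZMod p] Fin 3 → ZMod p :=
  ∑ i, crossProduct.compl₁₂ (LinearMap.proj i) (LinearMap.proj i)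

/-- The central product of copies of the Heisenberg group indexed by `ι`. -/
abbrev CrossPower : Type _ := BaerGroup (sumCross p ι)

variable {p ι}

theorem sumCross_apply (v w : ι → Fin 3 → ZMod p) : sumCross p ι v w = ∑ i, v i ⨯₃ w i := by
  simp [sumCross]

theorem isAlt_sumCross : (sumCross p ι).IsAlt := fun v => by simp [sumCross_apply]

/-- The pure tensor `a ⊗ u`, linear in `u`. -/
def tens (a : ι → ZMod p) : (Fin 3 → ZMod p) →ₗ[ZMod p] ι → Fin 3 → ZMod p :=
  LinearMap.pi fun i => a i • LinearMap.id

theorem tens_apply (a : ι → ZMod p) (u : Fin 3 → ZMod p) (i : ι) : tens a u i = a i • u := rfl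

theorem tens_sub (a b : ι → ZMod p) (u : Fin 3 → ZMod p) :
    tens (a - b) u = tens a u - tens b u := by
  ext; simp [tens_apply, sub_mul]

theorem tens_add (a b : ι → ZMod p) (u : Fin 3 → ZMod p) :
    tens (a + b) u = tens a u + tens b u := by
  ext; simp [tens_apply, add_mul]

theorem tens_smul (c : ZMod p) (a : ι → ZMod p) (u : Fin 3 → ZMod p) :
    tens (c • a) u = tens a (c • u) := by
  ext; simp [tens_apply]; ring

/-- The contraction with a vector. -/
def contract (a : ι → ZMod p) : (ι → Fin 3 → ZMod p) →ₗ[ZMod p] Fin 3 → ZMod p :=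
  ∑ i, a i • LinearMap.proj i

theorem contract_apply (a : ι → ZMod p) (v : ι → Fin 3 → ZMod p) :
    contract a v = ∑ i, a i • v i := by
  simp [contract]

theorem contract_apply_apply (a : ι → ZMod p) (v : ι → Fin 3 → ZMod p) (j : Fin 3) :
    contract a v j = a ⬝ᵥ fun i => v i j := by
  simp [contract_apply, dotProduct]

theorem contract_tens (a c : ι → ZMod p) (u : Fin 3 → ZMod p) :
    contract a (tens c u) = (a ⬝ᵥ c) • u := by
  simp [contract_apply, dotProduct, tens_apply, smul_smul, Finset.sum_smul]

theorem sumCross_tens_left (a : ι → ZMod p) (u : Fin 3 → ZMod p) (v : ι → Fin 3 → ZMod p) :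
    sumCross p ι (tens a u) v = u ⨯₃ contract a v := by
  simp [sumCross_apply, contract_apply, tens_apply]

theorem sumCross_tens_tens (a c : ι → ZMod p) (u v : Fin 3 → ZMod p) :
    sumCross p ι (tens a u) (tens c v) = (a ⬝ᵥ c) • (u ⨯₃ v) := by
  rw [sumCross_tens_left, contract_tens, map_smul]

variable [DecidableEq ι]

theorem sumCross_tens_single (x : ι → Fin 3 → ZMod p) (i : ι) (v : Fin 3 → ZMod p) :
    sumCross p ι x (tens (Pi.single i 1) v) = x i ⨯₃ v := by
  rw [sumCross_apply, Finset.sum_eq_single i]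
  · simp [tens_apply]
  · intro j _ hj; simp [tens_apply, hj]
  · simp

theorem sum_tens_single (x : ι → Fin 3 → ZMod p) : ∑ i, tens (Pi.single i 1) (x i) = x := by
  ext j k
  rw [Finset.sum_apply, Finset.sum_eq_single j] <;> simp +contextual [tens_apply, eq_comm]

theorem eq_zero_of_sumCross_right {x : ι → Fin 3 → ZMod p} (h : ∀ y, sumCross p ι x y = 0) :
    x = 0 :=
  funext fun i => eq_zero_of_cross_right fun v => by rw [← sumCross_tens_single]; exact h _

end Form

/-! ### Lines, frames and the decompositions they define. -/

section Line

variable {p : ℕ} {ι : Type*} [Fintype ι]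

/-- Turns commuting of two lines `a ⊗ F³` and `c ⊗ F³` into orthogonality of `a` and `c`. -/
theorem dotProduct_eq_zero_of_forall_smul_cross {c : ZMod p}
    (h : ∀ u v : Fin 3 → ZMod p, c • (u ⨯₃ v) = 0) : c = 0 := by
  have := congrFun (h ![1, 0, 0] ![0, 1, 0]) 2
  simpa [cross_apply] using this

/-- The subgroup of all elements of `CrossPower p ι` lying over a subspace. -/
def overSub (S : AddSubgroup (ι → Fin 3 → ZMod p)) : Subgroup (CrossPower p ι) :=
  (AddSubgroup.toSubgroup S).comap (BaerGroup.vecHom _)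

/-- The full preimage of `a ⊗ 𝔽ₚ³`. -/
def lineSubgroup (a : ι → ZMod p) : Subgroup (CrossPower p ι) :=
  overSub (tens a).range.toAddSubgroup

theorem mem_lineSubgroup {a : ι → ZMod p} {x : CrossPower p ι} :
    x ∈ lineSubgroup a ↔ ∃ u, tens a u = x.vec := Iff.rfl

theorem lineSubgroup_smul [Fact p.Prime] {c : ZMod p} (hc : c ≠ 0) (a : ι → ZMod p) :
    lineSubgroup (c • a) = lineSubgroup a := by
  ext x
  simp only [mem_lineSubgroup, tens_smul]
  constructor
  · rintro ⟨u, hu⟩; exact ⟨_, hu⟩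
  · rintro ⟨u, hu⟩; exact ⟨c⁻¹ • u, by rwa [smul_smul, mul_inv_cancel₀ hc, one_smul]⟩

/-- The homomorphism from the Heisenberg group onto `lineSubgroup a`. -/
def lineHom (a : ι → ZMod p) : Heis p →* CrossPower p ι :=
  BaerGroup.map (tens a) ((a ⬝ᵥ a) • LinearMap.id) fun u v => sumCross_tens_tens a a u v

variable [Fact p.Prime]

theorem tens_injective {a : ι → ZMod p} (ha : a ⬝ᵥ a ≠ 0) : Function.Injective (tens a) := by
  intro u v h
  have := congrArg (contract a) h
  rw [contract_tens, contract_tens] at this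
  exact smul_right_injective (Fin 3 → ZMod p) ha this

theorem lineHom_injective {a : ι → ZMod p} (ha : a ⬝ᵥ a ≠ 0) :
    Function.Injective (lineHom a) := by
  intro x y h
  ext1
  · exact tens_injective ha (congrArg BaerGroup.vec h)
  · exact smul_right_injective (Fin 3 → ZMod p) ha (congrArg BaerGroup.ctr h)

/-- Anisotropy makes the scalar by which `lineHom` acts on the centre invertible, so the whole
centre lies in the image. -/
theorem range_lineHom {a : ι → ZMod p} (ha : a ⬝ᵥ a ≠ 0) :
    (lineHom a).range = lineSubgroup a := by
  ext x
  constructor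
  · rintro ⟨y, rfl⟩; exact ⟨y.vec, rfl⟩
  · rintro ⟨u, hu⟩
    refine ⟨⟨u, (a ⬝ᵥ a)⁻¹ • x.ctr⟩, ?_⟩
    ext1
    · exact hu
    · change (a ⬝ᵥ a) • ((a ⬝ᵥ a)⁻¹ • x.ctr) = x.ctr
      rw [smul_smul, mul_inv_cancel₀ ha, one_smul]

theorem closure_tens_single [NeZero (2 : ZMod p)] {a : ι → ZMod p} (ha : a ⬝ᵥ a ≠ 0) :
    Subgroup.closure (Set.range fun i : Fin 3 =>
      (⟨tens a (Pi.single i 1), 0⟩ : CrossPower p ι)) = lineSubgroup a := by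
  rw [← range_lineHom ha, MonoidHom.range_eq_map, ← closure_range_gen, MonoidHom.map_closure,
    ← Set.range_comp]
  congr 2
  ext i : 1
  ext1
  · rfl
  · change (0 : Fin 3 → ZMod p) = (a ⬝ᵥ a) • (0 : Fin 3 → ZMod p)
    simp

/-- The members of a central decomposition attached to a frame are Heisenberg groups. -/
noncomputable def lineEquiv {a : ι → ZMod p} (ha : a ⬝ᵥ a ≠ 0) : Heis p ≃* lineSubgroup a :=
  (MonoidHom.ofInjective (lineHom_injective ha)).trans
    (MulEquiv.subgroupCongr (range_lineHom ha))

/-- An orthogonal basis of anisotropic vectors. -/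
structure IsFrame (a : ι → ι → ZMod p) : Prop where
  ortho : ∀ i j, i ≠ j → a i ⬝ᵥ a j = 0
  norm_ne : ∀ i, a i ⬝ᵥ a i ≠ 0

/-- The set of subgroups attached to a family of vectors. -/
def frameDecomposition (a : ι → ι → ZMod p) : Set (Subgroup (CrossPower p ι)) :=
  Set.range fun i => lineSubgroup (a i)

variable [DecidableEq ι]

theorem IsFrame.mul_transpose {a : ι → ι → ZMod p} (ha : IsFrame a) :
    of a * (of a)ᵀ = diagonal fun i => a i ⬝ᵥ a i := by
  ext i j
  rw [mul_apply', diagonal_apply]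
  split_ifs with h
  · subst h; rfl
  · exact ha.ortho i j h

theorem IsFrame.det_sq {a : ι → ι → ZMod p} (ha : IsFrame a) :
    (of a).det ^ 2 = ∏ i, a i ⬝ᵥ a i := by
  rw [← det_diagonal, ← ha.mul_transpose, det_mul, det_transpose, sq]

theorem IsFrame.det_ne_zero {a : ι → ι → ZMod p} (ha : IsFrame a) : (of a).det ≠ 0 := by
  have := ha.det_sq
  intro h
  rw [h, zero_pow two_ne_zero, eq_comm, Finset.prod_eq_zero_iff] at this
  obtain ⟨i, -, hi⟩ := this
  exact ha.norm_ne i hi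

theorem IsFrame.eq_zero_of_contract {a : ι → ι → ZMod p} (ha : IsFrame a)
    {v : ι → Fin 3 → ZMod p} (h : ∀ i, contract (a i) v = 0) : v = 0 := by
  ext i j
  have : (fun i => v i j) = 0 := by
    refine eq_zero_of_mulVec_eq_zero ha.det_ne_zero ?_
    ext i
    change a i ⬝ᵥ (fun i => v i j) = 0
    rw [← contract_apply_apply, h i, Pi.zero_apply]
  exact congrFun this i

theorem IsFrame.sum_tens {a : ι → ι → ZMod p} (ha : IsFrame a) (v : ι → Fin 3 → ZMod p) :
    ∑ i, tens (a i) ((a i ⬝ᵥ a i)⁻¹ • contract (a i) v) = v := by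
  rw [← sub_eq_zero]
  refine ha.eq_zero_of_contract fun j => ?_
  rw [map_sub, map_sum, Finset.sum_eq_single j]
  · rw [contract_tens, smul_smul, mul_inv_cancel₀ (ha.norm_ne j), one_smul, sub_self]
  · intro i _ hi
    rw [contract_tens, ha.ortho j i hi.symm, zero_smul]
  · simp

variable [NeZero (2 : ZMod p)]

theorem ctrSub_eq_top_of_tens {K : Subgroup (CrossPower p ι)} {a : ι → ZMod p}
    (ha : a ⬝ᵥ a ≠ 0) (h : ∀ u, tens a u ∈ BaerGroup.vecSub K) : BaerGroup.ctrSub K = ⊤ := by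
  refine span_cross_eq_top fun u v => ?_
  have := (BaerGroup.ctrSub K).smul_mem (a ⬝ᵥ a)⁻¹
    (BaerGroup.apply_mem_ctrSub isAlt_sumCross (h u) (h v))
  rwa [sumCross_tens_tens, smul_smul, inv_mul_cancel₀ ha, one_smul] at this

theorem eq_top_of_vecSub [Nonempty ι] {K : Subgroup (CrossPower p ι)}
    (h : BaerGroup.vecSub K = ⊤) : K = ⊤ := by
  obtain ⟨i⟩ := ‹Nonempty ι›
  refine BaerGroup.eq_top_of_vecSub_eq_top
    (ctrSub_eq_top_of_tens (a := Pi.single i 1) (by simp) fun u => h ▸ Submodule.mem_top) h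

theorem vecSub_sSup_eq_top {𝓗 : Set (Subgroup (CrossPower p ι))} (h : sSup 𝓗 = ⊤)
    {S : Submodule (ZMod p) (ι → Fin 3 → ZMod p)} (hS : ∀ K ∈ 𝓗, BaerGroup.vecSub K ≤ S) :
    S = ⊤ := by
  have : (⊤ : Subgroup (CrossPower p ι)) ≤ overSub S.toAddSubgroup :=
    h ▸ sSup_le fun K hK x hx => hS K hK ⟨x, hx, rfl⟩
  exact (Submodule.eq_top_iff').2 fun v => this (Subgroup.mem_top (⟨v, 0⟩ : CrossPower p ι))

theorem commute_iff_sumCross {x y : CrossPower p ι} :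
    Commute x y ↔ sumCross p ι x.vec y.vec = 0 :=
  BaerGroup.commute_iff_of_isAlt isAlt_sumCross

/-- Orthogonality gives commuting, and the orthogonal expansion `IsFrame.sum_tens` gives generation.
Contraction with `a j` kills every line but the `j`-th, so no line can be omitted. -/
theorem IsFrame.isFullyRefined [Nonempty ι] {a : ι → ι → ZMod p} (ha : IsFrame a) :
    IsFullyRefined (frameDecomposition a) := by
  refine ⟨⟨?_, ?_, ?_⟩, ?_⟩
  · rintro _ ⟨i, rfl⟩ _ ⟨j, rfl⟩ hne x ⟨u, hu⟩ y ⟨v, hv⟩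
    have hij : i ≠ j := fun h => hne (h ▸ rfl)
    rw [commute_iff_sumCross]
    change tens (a i) u = x.vec at hu
    change tens (a j) v = y.vec at hv
    rw [← hu, ← hv, sumCross_tens_tens, ha.ortho i j hij, zero_smul]
  · refine eq_top_of_vecSub ((Submodule.eq_top_iff').2 fun v => ?_)
    rw [← ha.sum_tens v]
    refine Submodule.sum_mem _ fun i _ => ?_
    have : lineSubgroup (a i) ≤ sSup (frameDecomposition a) := le_sSup ⟨i, rfl⟩
    exact ⟨⟨_, 0⟩, this ⟨_, rfl⟩, rfl⟩
  · intro 𝓙 hJ htop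
    obtain ⟨_, ⟨j, rfl⟩, hj⟩ := Set.exists_of_ssubset hJ
    have hker : (contract (a j)).ker = ⊤ := by
      refine vecSub_sSup_eq_top htop fun K hK => ?_
      obtain ⟨i, rfl⟩ := hJ.1 hK
      have hij : j ≠ i := fun h => hj (h ▸ hK)
      rintro _ ⟨x, ⟨u, hu⟩, rfl⟩
      change tens (a i) u = x.vec at hu
      change contract (a j) x.vec = 0
      rw [← hu, contract_tens, ha.ortho j i hij, zero_smul]
    have h1 : tens (a j) ![1, 0, 0] ∈ (contract (a j)).ker := hker ▸ Submodule.mem_top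
    rw [LinearMap.mem_ker, contract_tens] at h1
    have := congrFun h1 0
    simp [ha.norm_ne j] at this
  · rintro _ ⟨i, rfl⟩
    exact (isCentrallyIndecomposable p).of_equiv (lineEquiv (ha.norm_ne i))

end Line

/-! ### Every fully refined decomposition comes from a frame. -/

section Converse

variable {p : ℕ} [Fact p.Prime] [NeZero (2 : ZMod p)] {ι : Type*} [Fintype ι] [DecidableEq ι]

/-- A common vector is orthogonal to both summands, hence to everything, and the form is
nondegenerate. -/
theorem disjoint_of_orthogonal {V₁ V₂ : Submodule (ZMod p) (ι → Fin 3 → ZMod p)}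
    (htop : V₁ ⊔ V₂ = ⊤) (horth : ∀ x ∈ V₁, ∀ y ∈ V₂, sumCross p ι x y = 0) : Disjoint V₁ V₂ := by
  rw [Submodule.disjoint_def]
  intro x h1 h2
  refine eq_zero_of_sumCross_right fun y => ?_
  obtain ⟨y1, hy1, y2, hy2, rfl⟩ := Submodule.mem_sup.1 (htop ▸ Submodule.mem_top : y ∈ V₁ ⊔ V₂)
  rw [map_add, horth x h1 y2 hy2, ← isAlt_sumCross.neg, horth y1 hy1 x h2, neg_zero, add_zero]

/-- Every vector is an eigenvector of `f`, so `f` is a scalar. -/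
theorem exists_eq_smul_of_cross_self {f : (Fin 3 → ZMod p) →ₗ[ZMod p] Fin 3 → ZMod p}
    (h : ∀ u, u ⨯₃ f u = 0) : ∃ c : ZMod p, ∀ u, f u = c • u := by
  obtain ⟨c, hc⟩ := f.exists_eq_smul_id_of_forall_notLinearIndependent fun u hu =>
    (crossProduct_ne_zero_iff_linearIndependent.2 hu) (h u)
  exact ⟨c, fun u => by rw [hc]; rfl⟩

/-- Both summands of an orthogonal decomposition of `A ⊗ 𝔽ₚ³` are stable under the
endomorphisms of `𝔽ₚ³`. -/
theorem exists_tens_mem {V₁ V₂ : Submodule (ZMod p) (ι → Fin 3 → ZMod p)}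
    (htop : V₁ ⊔ V₂ = ⊤) (horth : ∀ x ∈ V₁, ∀ y ∈ V₂, sumCross p ι x y = 0)
    (a : ι → ZMod p) : ∃ c : ι → ZMod p, ∀ u, tens c u ∈ V₁ ∧ tens (a - c) u ∈ V₂ := by
  have hcompl : IsCompl V₁ V₂ :=
    ⟨disjoint_of_orthogonal htop horth, codisjoint_iff.2 htop⟩
  let π : (ι → Fin 3 → ZMod p) →ₗ[ZMod p] ι → Fin 3 → ZMod p :=
    V₁.projection V₂ hcompl
  have hπ1 : ∀ x, π x ∈ V₁ := fun x => Submodule.projection_apply_mem hcompl x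
  have hπ2 : ∀ x, x - π x ∈ V₂ := fun x => Submodule.sub_projection_mem hcompl x
  have hadj : ∀ x y, sumCross p ι (π x) y = sumCross p ι x (π y) := fun x y => by
    have h1 := horth _ (hπ1 x) _ (hπ2 y)
    have h2 := horth _ (hπ1 y) _ (hπ2 x)
    rw [← isAlt_sumCross.neg, neg_eq_zero] at h2
    rw [map_sub, sub_eq_zero] at h1
    rw [map_sub, LinearMap.sub_apply, sub_eq_zero] at h2
    rw [h1, h2]
  have hscal : ∀ i, ∃ c : ZMod p, ∀ u, π (tens a u) i = c • u := fun i => by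
    refine exists_eq_smul_of_cross_self (f := LinearMap.proj i ∘ₗ π ∘ₗ tens a) fun u => ?_
    -- Moving the self-adjoint `π` to the other argument turns the triple product into `u` dotted
    -- with a cross product having `u` as a factor.
    refine dotProduct_eq_zero _ fun v => ?_
    change u ⨯₃ (π (tens a u) i) ⬝ᵥ v = 0
    rw [dotProduct_comm, triple_product_permutation, ← sumCross_tens_single, hadj,
      sumCross_tens_left, dot_self_cross]
  choose c hc using hscal
  have hc' : ∀ u, tens c u = π (tens a u) := fun u => funext fun i => (hc i u).symm
  exact ⟨c, fun u => ⟨hc' u ▸ hπ1 _, by rw [tens_sub, hc' u]; exact hπ2 _⟩⟩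

/-- Otherwise the vectors `a` with `a ⊗ F³ ⊆ V₁` form a totally isotropic space, by polarization.
The component in it of each standard basis vector is then orthogonal to all standard basis vectors,
so it vanishes; thus `V₂` is everything and `V₁ = ⊥`. -/
theorem exists_anisotropic {V₁ V₂ : Submodule (ZMod p) (ι → Fin 3 → ZMod p)}
    (htop : V₁ ⊔ V₂ = ⊤) (horth : ∀ x ∈ V₁, ∀ y ∈ V₂, sumCross p ι x y = 0) (hne : V₁ ≠ ⊥) :
    ∃ a : ι → ZMod p, a ⬝ᵥ a ≠ 0 ∧ ∀ u, tens a u ∈ V₁ := by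
  by_contra! hcon
  have hiso : ∀ a : ι → ZMod p, (∀ u, tens a u ∈ V₁) → a ⬝ᵥ a = 0 := fun a ha => by
    by_contra h
    obtain ⟨u, hu⟩ := hcon a h
    exact hu (ha u)
  have hiso2 : ∀ a b : ι → ZMod p, (∀ u, tens a u ∈ V₁) → (∀ u, tens b u ∈ V₁) → a ⬝ᵥ b = 0 := by
    intro a b ha hb
    have h := hiso (a + b) fun u => by rw [tens_add]; exact add_mem (ha u) (hb u)
    rw [add_dotProduct, dotProduct_add, dotProduct_add, hiso a ha, hiso b hb, dotProduct_comm b a,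
      zero_add, add_zero, ← two_mul] at h
    exact (mul_eq_zero.1 h).resolve_left (NeZero.ne _)
  choose t ht using fun i : ι => exists_tens_mem htop horth (Pi.single i 1)
  have ht0 : ∀ i, t i = 0 := fun i => by
    ext j
    have h : t i ⬝ᵥ (Pi.single j 1 - t j) = 0 := dotProduct_eq_zero_of_forall_smul_cross
      fun u v => by rw [← sumCross_tens_tens]; exact horth _ (ht i u).1 _ (ht j v).2
    rwa [dotProduct_sub, hiso2 _ _ (fun u => (ht i u).1) (fun u => (ht j u).1), sub_zero,
      dotProduct_single_one] at h
  refine hne ((Submodule.eq_bot_iff _).2 fun x hx => ?_)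
  refine Submodule.disjoint_def.1 (disjoint_of_orthogonal htop horth) x hx ?_
  rw [← sum_tens_single x]
  refine Submodule.sum_mem _ fun i _ => ?_
  have := (ht i (x i)).2
  rwa [ht0, sub_zero] at this

/-- The image of `K` and that of the join of the other members are orthogonal with sum everything.
The former is nonzero: if it were zero, the other members would generate the group modulo the centre
and hence the group, against minimality. -/
theorem exists_tens_mem_vecSub [Nonempty ι] {𝓚 : Set (Subgroup (CrossPower p ι))}
    (h : IsCentralDecomposition 𝓚) {K : Subgroup (CrossPower p ι)} (hK : K ∈ 𝓚) :
    ∃ a : ι → ZMod p, a ⬝ᵥ a ≠ 0 ∧ ∀ u, tens a u ∈ BaerGroup.vecSub K := by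
  obtain ⟨hc, hs, hm⟩ := h
  have hle : ∀ L ∈ 𝓚, L ≠ K → L ≤ sSup (𝓚 \ {K}) := fun L hL hne => le_sSup ⟨hL, hne⟩
  refine exists_anisotropic (V₂ := BaerGroup.vecSub (sSup (𝓚 \ {K}))) ?_ ?_ ?_
  · refine vecSub_sSup_eq_top hs fun L hL => ?_
    by_cases hLK : L = K
    · exact hLK ▸ le_sup_left
    · exact (BaerGroup.vecSub_mono (hle L hL hLK)).trans le_sup_right
  · rintro _ ⟨x, hx, rfl⟩ _ ⟨y, hy, rfl⟩
    have : sSup (𝓚 \ {K}) ≤ overSub (sumCross p ι x.vec).ker.toAddSubgroup :=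
      sSup_le fun L hL z hz =>
        commute_iff_sumCross.1 (hc K hK L hL.1 (Ne.symm hL.2) x hx z hz)
    exact this hy
  · intro hbot
    refine hm (𝓚 \ {K}) (Set.sdiff_singleton_ssubset.2 hK) (eq_top_of_vecSub ?_)
    refine vecSub_sSup_eq_top hs fun L hL => ?_
    by_cases hLK : L = K
    · rw [hLK, hbot]; exact bot_le
    · exact BaerGroup.vecSub_mono (hle L hL hLK)

/-- A centrally indecomposable subgroup over an anisotropic `a ⊗ 𝔽ₚ³` equals its preimage. -/
theorem eq_lineSubgroup {K : Subgroup (CrossPower p ι)} (hK : IsCentrallyIndecomposable K)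
    {a : ι → ZMod p} (ha : a ⬝ᵥ a ≠ 0) (h : ∀ u, tens a u ∈ BaerGroup.vecSub K) :
    K = lineSubgroup a := by
  have hctr := ctrSub_eq_top_of_tens ha h
  have hle : lineSubgroup a ≤ K := fun x ⟨u, hu⟩ =>
    BaerGroup.mem_of_ctrSub_eq_top hctr ((show tens a u = x.vec from hu) ▸ h u)
  refine le_antisymm ?_ hle
  -- `C` consists of the elements of `K` commuting with the line. If `S ≠ ⊤`, orthogonal projection
  -- to `a ⊗ F³` shows that `{S, C}` is a central decomposition of `K`, and indecomposability forces
  -- `S = ⊤` after all.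
  set S : Subgroup K := (lineSubgroup a).subgroupOf K with hS
  set C : Subgroup K := (overSub (contract a).ker.toAddSubgroup).subgroupOf K with hC
  rw [← Subgroup.subgroupOf_eq_top]
  by_contra hST
  have hCT : C ≠ ⊤ := fun hCT => by
    have h1 : (⟨tens a ![1, 0, 0], 0⟩ : CrossPower p ι) ∈ overSub (contract a).ker.toAddSubgroup :=
      Subgroup.subgroupOf_eq_top.1 hCT (hle ⟨_, rfl⟩)
    have h2 : contract a (tens a ![1, 0, 0]) = 0 := h1
    rw [contract_tens] at h2
    have := congrFun h2 0
    simp [ha] at this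
  have hcomm : ∀ x ∈ S, ∀ y ∈ C, Commute x y := by
    rintro ⟨x, hx⟩ ⟨u, hu⟩ ⟨y, hy⟩ hyC
    change tens a u = x.vec at hu
    have hyC : contract a y.vec = 0 := hyC
    have : Commute x y := by
      rw [commute_iff_sumCross, ← hu, sumCross_tens_left, hyC, map_zero]
    exact Subtype.ext this
  have hdec : IsCentralDecomposition ({S, C} : Set (Subgroup K)) := by
    refine ⟨?_, ?_, ?_⟩
    · rintro H (rfl | rfl) L (rfl | rfl) hne x hx y hy
      · exact absurd rfl hne
      · exact hcomm x hx y hy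
      · exact (hcomm y hy x hx).symm
      · exact absurd rfl hne
    · rw [sSup_pair, Subgroup.eq_top_iff']
      rintro ⟨x, hx⟩
      set s : CrossPower p ι := ⟨tens a ((a ⬝ᵥ a)⁻¹ • contract a x.vec), 0⟩ with hs
      have hsK : s ∈ K := hle ⟨_, rfl⟩
      have hsS : (⟨s, hsK⟩ : K) ∈ S := ⟨_, rfl⟩
      have hsC : (⟨s, hsK⟩ : K)⁻¹ * ⟨x, hx⟩ ∈ C := by
        change contract a (-tens a ((a ⬝ᵥ a)⁻¹ • contract a x.vec) + x.vec) = 0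
        rw [map_add, map_neg, contract_tens, smul_smul, mul_inv_cancel₀ ha, one_smul,
          neg_add_cancel]
      rw [← mul_inv_cancel_left (⟨s, hsK⟩ : K) ⟨x, hx⟩]
      exact mul_mem (Subgroup.mem_sup_left hsS) (Subgroup.mem_sup_right hsC)
    · intro 𝓙 hJ htop
      obtain ⟨L, hL, hLJ⟩ := Set.exists_of_ssubset hJ
      rcases hL with rfl | rfl
      · refine hCT (top_le_iff.1 (htop ▸ sSup_le fun M hM => ?_))
        rcases hJ.1 hM with rfl | rfl
        · exact absurd hM hLJ
        · exact le_rfl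
      · refine hST (top_le_iff.1 (htop ▸ sSup_le fun M hM => ?_))
        rcases hJ.1 hM with rfl | rfl
        · exact le_rfl
        · exact absurd hM hLJ
  have : S ∈ ({⊤} : Set (Subgroup K)) := hK _ hdec ▸ Set.mem_insert _ _
  exact hST this

/-- One anisotropic vector per member yields an orthogonal family. It is independent because it is
orthogonal and anisotropic, and spanning because the members generate; being a basis, it can be
indexed by `ι`. -/
theorem exists_isFrame [Nonempty ι] {𝓚 : Set (Subgroup (CrossPower p ι))}
    (h : IsFullyRefined 𝓚) : ∃ a : ι → ι → ZMod p, IsFrame a ∧ 𝓚 = frameDecomposition a := by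
  choose a ha ha' using fun K : 𝓚 => exists_tens_mem_vecSub h.1 K.2
  have hline : ∀ K : 𝓚, K.1 = lineSubgroup (a K) := fun K =>
    eq_lineSubgroup (h.2 _ K.2) (ha K) (ha' K)
  have horth : ∀ K L : 𝓚, K ≠ L → a K ⬝ᵥ a L = 0 := fun K L hne =>
    dotProduct_eq_zero_of_forall_smul_cross fun u v => by
      rw [← sumCross_tens_tens]
      refine (commute_iff_sumCross (x := ⟨tens (a K) u, 0⟩) (y := ⟨tens (a L) v, 0⟩)).1
        (h.1.1 K K.2 L L.2 (fun h => hne (Subtype.ext h)) _ ?_ _ ?_)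
      · rw [hline K]; exact ⟨u, rfl⟩
      · rw [hline L]; exact ⟨v, rfl⟩
  have hli : LinearIndependent (ZMod p) a := by
    rw [linearIndependent_iff']
    intro s c hc K hK
    have := congrArg (a K ⬝ᵥ ·) hc
    simp only [dotProduct_sum, dotProduct_smul, dotProduct_zero] at this
    rw [Finset.sum_eq_single K (fun L _ hL => by rw [horth K L hL.symm, smul_zero])
      (fun h => absurd hK h)] at this
    exact (smul_eq_zero.1 this).resolve_right (ha K)
  have hspan : ⊤ ≤ Submodule.span (ZMod p) (Set.range a) := by
    intro x _
    -- The tensors whose zeroth column lies in the span of the family; every member lies over `S`.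
    let S : Submodule (ZMod p) (ι → Fin 3 → ZMod p) :=
      (Submodule.span (ZMod p) (Set.range a)).comap
        (LinearMap.pi fun i => LinearMap.proj 0 ∘ₗ LinearMap.proj i)
    have hS : S = ⊤ := by
      refine vecSub_sSup_eq_top h.1.2.1 fun K hK => ?_
      rintro _ ⟨y, hy, rfl⟩
      have hle : K ≤ lineSubgroup (a ⟨K, hK⟩) := (hline ⟨K, hK⟩).le
      obtain ⟨u, hu⟩ := hle hy
      change tens (a ⟨K, hK⟩) u = y.vec at hu
      change y.vec ∈ S
      rw [← hu]
      have : (fun i => tens (a ⟨K, hK⟩) u i 0) = u 0 • a ⟨K, hK⟩ := by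
        ext i; simp [tens_apply, mul_comm]
      change (fun i => tens (a ⟨K, hK⟩) u i 0) ∈ Submodule.span (ZMod p) (Set.range a)
      rw [this]
      exact Submodule.smul_mem _ _ (Submodule.subset_span ⟨_, rfl⟩)
    have hx : tens x ![1, 0, 0] ∈ S := hS ▸ Submodule.mem_top
    have hx' : (fun i => tens x ![1, 0, 0] i 0) ∈ Submodule.span (ZMod p) (Set.range a) := hx
    simpa [tens_apply] using hx'
  let e : ι ≃ 𝓚 := (Pi.basisFun (ZMod p) ι).indexEquiv (Module.Basis.mk hli hspan)
  refine ⟨fun i => a (e i), ⟨fun i j hij => horth _ _ (e.injective.ne hij), fun i => ha _⟩, ?_⟩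
  ext K
  constructor
  · intro hK
    exact ⟨e.symm ⟨K, hK⟩, by simp [← hline]⟩
  · rintro ⟨i, rfl⟩
    simp only [← hline]
    exact (e i).2

end Converse

end Heisenberg

/-! ### Automorphisms induced by similitudes. -/

namespace Heisenberg

open Matrix

section Similitude

variable {p : ℕ} [Fact p.Prime] {ι : Type*} [Fintype ι] [DecidableEq ι]

/-- The action of a matrix on the first tensor factor. -/
def tensMap (T : Matrix ι ι (ZMod p)) :
    (ι → Fin 3 → ZMod p) →ₗ[ZMod p] ι → Fin 3 → ZMod p :=
  LinearMap.pi fun i => contract (T i)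

theorem tensMap_tens (T : Matrix ι ι (ZMod p)) (a : ι → ZMod p) (u : Fin 3 → ZMod p) :
    tensMap T (tens a u) = tens (T *ᵥ a) u :=
  funext fun i => contract_tens (T i) a u

theorem mulVec_dotProduct_mulVec {T : Matrix ι ι (ZMod p)} {ω : ZMod p} (hT : Tᵀ * T = ω • 1)
    (a c : ι → ZMod p) : (T *ᵥ a) ⬝ᵥ (T *ᵥ c) = ω * (a ⬝ᵥ c) := by
  rw [dotProduct_mulVec, ← vecMul_transpose, vecMul_vecMul, hT, vecMul_smul, vecMul_one,
    smul_dotProduct, smul_eq_mul]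

theorem sumCross_tensMap {T : Matrix ι ι (ZMod p)} {ω : ZMod p} (hT : Tᵀ * T = ω • 1)
    (v w : ι → Fin 3 → ZMod p) :
    sumCross p ι (tensMap T v) (tensMap T w) = ω • sumCross p ι v w := by
  rw [← sum_tens_single v, ← sum_tens_single w]
  simp only [map_sum, LinearMap.sum_apply, tensMap_tens, sumCross_tens_tens,
    mulVec_dotProduct_mulVec hT, Finset.smul_sum, smul_smul]

theorem tensMap_injective {T : Matrix ι ι (ZMod p)} {ω : ZMod p} (hω : ω ≠ 0)
    (hT : Tᵀ * T = ω • 1) : Function.Injective (tensMap T) := by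
  rw [injective_iff_map_eq_zero]
  intro v hv
  refine eq_zero_of_sumCross_right fun w => ?_
  have := sumCross_tensMap hT v w
  rw [hv, map_zero, LinearMap.zero_apply, eq_comm] at this
  exact (smul_eq_zero.1 this).resolve_left hω

/-- The automorphism of the central power induced by a similitude. -/
noncomputable def similitudeAut {T : Matrix ι ι (ZMod p)} {ω : ZMod p} (hω : ω ≠ 0)
    (hT : Tᵀ * T = ω • 1) : MulAut (CrossPower p ι) :=
  BaerGroup.mapEquiv (LinearEquiv.ofInjectiveEndo (tensMap T) (tensMap_injective hω hT))
    (LinearEquiv.smulOfNeZero (ZMod p) (Fin 3 → ZMod p) ω hω) (sumCross_tensMap hT)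

theorem similitudeAut_smul_frameDecomposition {T : Matrix ι ι (ZMod p)} {ω : ZMod p} (hω : ω ≠ 0)
    (hT : Tᵀ * T = ω • 1) (a : ι → ι → ZMod p) :
    similitudeAut hω hT • frameDecomposition a = frameDecomposition fun i => T *ᵥ a i := by
  rw [← Set.image_smul, frameDecomposition, ← Set.range_comp]
  congr 1
  ext i x
  simp only [Function.comp_apply, Subgroup.mem_smul_pointwise_iff_exists, mem_lineSubgroup]
  constructor
  · rintro ⟨y, ⟨u, hu⟩, rfl⟩
    refine ⟨u, ?_⟩
    rw [← tensMap_tens, hu]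
    rfl
  · rintro ⟨u, hu⟩
    obtain ⟨y, rfl⟩ := (similitudeAut hω hT).surjective x
    refine ⟨y, ⟨u, tensMap_injective hω hT ?_⟩, rfl⟩
    rw [tensMap_tens, hu]
    rfl

theorem similitudeAut_mem {T : Matrix ι ι (ZMod p)} (hT : Tᵀ * T = (1 : ZMod p) • 1) :
    similitudeAut one_ne_zero hT ∈ autCentralizingDerived (CrossPower p ι) := by
  rw [mem_autCentralizingDerived_iff]
  intro x hx
  have hx0 := BaerGroup.vec_eq_zero_of_mem_commutator hx
  ext1
  · change tensMap T x.vec = x.vec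
    rw [hx0, map_zero]
  · change (1 : ZMod p) • x.ctr = x.ctr
    rw [one_smul]

end Similitude

/-! ### The number of nonsquare norms, and isometries between frames. -/

section Count

variable {p : ℕ} [Fact p.Prime] {ι : Type*} [Fintype ι] [DecidableEq ι]

/-- The number of vectors of a family whose norm is not a square. -/
def nonsquareCount (a : ι → ι → ZMod p) : ℕ :=
  (Finset.univ.filter fun i => quadraticChar (ZMod p) (a i ⬝ᵥ a i) = -1).card

theorem quadraticChar_eq_one_iff_ne {x : ZMod p} (hx : x ≠ 0) :
    quadraticChar (ZMod p) x = 1 ↔ quadraticChar (ZMod p) x ≠ -1 := by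
  rcases quadraticChar_dichotomy hx with h | h <;> rw [h] <;> decide

/-- The product of the norms is the determinant of the Gram matrix, hence a nonzero square. -/
theorem IsFrame.even_nonsquareCount {a : ι → ι → ZMod p} (ha : IsFrame a) :
    Even (nonsquareCount a) := by
  have h1 : quadraticChar (ZMod p) (∏ i, a i ⬝ᵥ a i) = 1 := by
    rw [← ha.det_sq]
    exact quadraticChar_sq_one' ha.det_ne_zero
  rw [map_prod] at h1
  have h2 : ∏ i, quadraticChar (ZMod p) (a i ⬝ᵥ a i) = (-1) ^ nonsquareCount a := by
    rw [nonsquareCount, ← Finset.prod_const, Finset.prod_filter]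
    refine Finset.prod_congr rfl fun i _ => ?_
    split_ifs with h
    · exact h
    · exact (quadraticChar_eq_one_iff_ne (ha.norm_ne i)).2 h
  rw [h2] at h1
  by_contra hodd
  rw [(Nat.not_even_iff_odd.1 hodd).neg_one_pow] at h1
  exact absurd h1 (by decide)

theorem nonsquareCount_le (a : ι → ι → ZMod p) : nonsquareCount a ≤ Fintype.card ι :=
  Finset.card_le_univ _

/-- Here `x * y` is a nonzero square `r * r`, and `c = r / y`. -/
theorem exists_sq_mul_eq {x y : ZMod p} (hx : x ≠ 0) (hy : y ≠ 0)
    (h : quadraticChar (ZMod p) x = quadraticChar (ZMod p) y) : ∃ c ≠ 0, c ^ 2 * y = x := by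
  have h1 : quadraticChar (ZMod p) (x * y) = 1 := by
    rw [map_mul, h, ← sq, quadraticChar_sq_one hy]
  obtain ⟨r, hr⟩ := (quadraticChar_one_iff_isSquare (mul_ne_zero hx hy)).1 h1
  have hr0 : r ≠ 0 := by
    rintro rfl
    exact mul_ne_zero hx hy (by simpa using hr)
  refine ⟨r / y, div_ne_zero hr0 hy, ?_⟩
  field_simp
  linear_combination -hr

theorem exists_perm_of_nonsquareCount_eq {a c : ι → ι → ZMod p} (ha : IsFrame a) (hc : IsFrame c)
    (h : nonsquareCount a = nonsquareCount c) : ∃ σ : Equiv.Perm ι, ∀ i,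
      quadraticChar (ZMod p) (a i ⬝ᵥ a i) = quadraticChar (ZMod p) (c (σ i) ⬝ᵥ c (σ i)) := by
  have e : {i // quadraticChar (ZMod p) (a i ⬝ᵥ a i) = -1} ≃
      {i // quadraticChar (ZMod p) (c i ⬝ᵥ c i) = -1} :=
    Fintype.equivOfCardEq (by rw [Fintype.card_subtype, Fintype.card_subtype]; exact h)
  refine ⟨e.extendSubtype, fun i => ?_⟩
  by_cases hi : quadraticChar (ZMod p) (a i ⬝ᵥ a i) = -1
  · rw [hi, e.extendSubtype_mem i hi]
  · rw [(quadraticChar_eq_one_iff_ne (ha.norm_ne i)).2 hi,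
      (quadraticChar_eq_one_iff_ne (hc.norm_ne _)).2 (e.extendSubtype_not_mem i hi)]

/-- With the frames as rows of `A` and `C`, take `T = Cᵀ (Aᵀ)⁻¹`. Equality of the Gram matrices `A
Aᵀ = C Cᵀ` makes `T` orthogonal. -/
theorem exists_isometry {a c : ι → ι → ZMod p} (ha : IsFrame a) (hc : IsFrame c)
    (h : ∀ i, a i ⬝ᵥ a i = c i ⬝ᵥ c i) :
    ∃ T : Matrix ι ι (ZMod p), Tᵀ * T = (1 : ZMod p) • 1 ∧ ∀ i, T *ᵥ a i = c i := by
  have hA : IsUnit (of a).det := ha.det_ne_zero.isUnit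
  have hAt : IsUnit (of a)ᵀ.det := by rwa [det_transpose]
  have hT : ((of c)ᵀ * ((of a)ᵀ)⁻¹) * (of a)ᵀ = (of c)ᵀ := nonsing_inv_mul_cancel_right _ _ hAt
  refine ⟨(of c)ᵀ * ((of a)ᵀ)⁻¹, ?_, fun i => ?_⟩
  · set T := (of c)ᵀ * ((of a)ᵀ)⁻¹
    have h1 : of a * (Tᵀ * T) * (of a)ᵀ = of a * 1 * (of a)ᵀ := by
      calc of a * (Tᵀ * T) * (of a)ᵀ = (T * (of a)ᵀ)ᵀ * (T * (of a)ᵀ) := by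
            simp only [transpose_mul, transpose_transpose, Matrix.mul_assoc]
        _ = of a * 1 * (of a)ᵀ := by
            rw [hT, transpose_transpose, hc.mul_transpose, Matrix.mul_one, ha.mul_transpose]
            simp only [h]
    rw [one_smul]
    have h2 := congrArg (fun M => (of a)⁻¹ * (M * ((of a)ᵀ)⁻¹)) h1
    simpa [mul_nonsing_inv_cancel_right _ _ hAt, nonsing_inv_mul_cancel_left _ _ hA,
      nonsing_inv_mul _ hA] using h2
  · ext j
    exact congrFun (congrFun hT j) i

/-- Reorder `c` to match square classes, then rescale it to match norms. Neither changes the set of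
lines, and the resulting isometry has multiplier `1`. -/
theorem exists_aut_of_nonsquareCount_eq {a c : ι → ι → ZMod p} (ha : IsFrame a) (hc : IsFrame c)
    (h : nonsquareCount a = nonsquareCount c) :
    ∃ φ ∈ autCentralizingDerived (CrossPower p ι),
      φ • frameDecomposition a = frameDecomposition c := by
  obtain ⟨σ, hσ⟩ := exists_perm_of_nonsquareCount_eq ha hc h
  choose r hr0 hr using fun i => exists_sq_mul_eq (ha.norm_ne i) (hc.norm_ne (σ i)) (hσ i)
  have hc' : IsFrame fun i => r i • c (σ i) := by
    refine ⟨fun i j hij => ?_, fun i => ?_⟩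
    · simp [hc.ortho _ _ (σ.injective.ne hij)]
    · simp [hr0 i, hc.norm_ne (σ i)]
  obtain ⟨T, hT, hTa⟩ := exists_isometry ha hc' fun i => by simp [← hr i]; ring
  refine ⟨_, similitudeAut_mem hT, ?_⟩
  rw [similitudeAut_smul_frameDecomposition]
  simp only [hTa, frameDecomposition, lineSubgroup_smul (hr0 _)]
  exact σ.surjective.range_comp fun i => lineSubgroup (c i)

end Count

/-! ### How an arbitrary automorphism changes the count. -/

section Invariance

variable {p : ℕ} [Fact p.Prime] [NeZero (2 : ZMod p)] {ι : Type*} [Fintype ι] [DecidableEq ι]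

theorem vec_eq_zero_of_central {x : CrossPower p ι} (h : ∀ y, Commute x y) : x.vec = 0 :=
  eq_zero_of_sumCross_right fun v => commute_iff_sumCross.1 (h ⟨v, 0⟩)

theorem vec_map_eq_zero (φ : MulAut (CrossPower p ι)) {x : CrossPower p ι} (hx : x.vec = 0) :
    (φ x).vec = 0 := by
  refine vec_eq_zero_of_central fun y => ?_
  obtain ⟨y, rfl⟩ := φ.surjective y
  refine Commute.map ?_ φ
  rw [commute_iff_sumCross, hx, map_zero, LinearMap.zero_apply]

theorem map_ctr_eq (φ : MulAut (CrossPower p ι)) (w : Fin 3 → ZMod p) :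
    φ ⟨0, w⟩ = ⟨0, (φ ⟨0, w⟩).ctr⟩ := by
  ext1
  · exact vec_map_eq_zero φ rfl
  · rfl

/-- The linear map induced by an automorphism on the quotient by the centre. -/
def autVec (φ : MulAut (CrossPower p ι)) : (ι → Fin 3 → ZMod p) →ₗ[ZMod p] ι → Fin 3 → ZMod p :=
  AddMonoidHom.toZModLinearMap p
    { toFun := fun v => (φ ⟨v, 0⟩).vec
      map_zero' := vec_map_eq_zero φ rfl
      map_add' := fun v w => by
        -- The map `v ↦ (v, 0)` is multiplicative up to a central factor, and `φ` preserves the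
        -- centre.
        have h : (⟨v, 0⟩ * ⟨w, 0⟩ : CrossPower p ι) = ⟨v + w, 0⟩ * ⟨0, sumCross p ι v w⟩ := by
          ext1 <;> simp
        have := congrArg (fun x => (φ x).vec) h
        simp only [map_mul, BaerGroup.vec_mul] at this
        rw [this, vec_map_eq_zero φ (x := ⟨0, _⟩) rfl, add_zero] }

/-- The linear map induced by an automorphism on the centre. -/
def autCtr (φ : MulAut (CrossPower p ι)) : (Fin 3 → ZMod p) →ₗ[ZMod p] Fin 3 → ZMod p :=
  AddMonoidHom.toZModLinearMap p
    { toFun := fun w => (φ ⟨0, w⟩).ctr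
      map_zero' := by
        have : (⟨0, 0⟩ : CrossPower p ι) = 1 := rfl
        rw [this, map_one, BaerGroup.ctr_one]
      map_add' := fun v w => by
        have h : (⟨0, v + w⟩ : CrossPower p ι) = ⟨0, v⟩ * ⟨0, w⟩ := by
          ext1 <;> simp
        rw [h, map_mul, BaerGroup.ctr_mul, vec_map_eq_zero φ (x := ⟨0, v⟩) rfl, map_zero,
          LinearMap.zero_apply, add_zero] }

/-- `φ` respects commutators, which are twice the values of the form. -/
theorem sumCross_autVec (φ : MulAut (CrossPower p ι)) (v w : ι → Fin 3 → ZMod p) :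
    sumCross p ι (autVec φ v) (autVec φ w) = autCtr φ (sumCross p ι v w) := by
  have h := map_commutatorElement φ (⟨v, 0⟩ : CrossPower p ι) ⟨w, 0⟩
  rw [BaerGroup.commutatorElement_eq isAlt_sumCross,
    BaerGroup.commutatorElement_eq isAlt_sumCross] at h
  have h2 : autCtr φ ((2 : ZMod p) • sumCross p ι v w) =
      (2 : ZMod p) • sumCross p ι (autVec φ v) (autVec φ w) := congrArg BaerGroup.ctr h
  rw [map_smul] at h2
  exact (smul_right_injective (Fin 3 → ZMod p) (NeZero.ne (2 : ZMod p)) h2).symm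

theorem autCtr_injective (φ : MulAut (CrossPower p ι)) : Function.Injective (autCtr φ) := by
  intro v w h
  have h1 : φ ⟨0, v⟩ = φ ⟨0, w⟩ := by
    rw [map_ctr_eq φ v, map_ctr_eq φ w]
    exact congrArg _ h
  exact congrArg BaerGroup.ctr (φ.injective h1)

theorem det_autCtr_ne_zero (φ : MulAut (CrossPower p ι)) :
    (LinearMap.toMatrix' (autCtr φ)).det ≠ 0 := by
  rw [LinearMap.det_toMatrix']
  exact (LinearEquiv.isUnit_det' (LinearEquiv.ofInjectiveEndo _ (autCtr_injective φ))).ne_zero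

/-- Commutators within a single component already span the centre. -/
theorem autCtr_eq_id [Nonempty ι] {φ : MulAut (CrossPower p ι)}
    (h : φ ∈ autCentralizingDerived (CrossPower p ι)) : autCtr φ = LinearMap.id := by
  have hfix := mem_autCentralizingDerived_iff.1 h
  obtain ⟨i⟩ := ‹Nonempty ι›
  have hS : (autCtr φ - LinearMap.id).ker = ⊤ := by
    refine span_cross_eq_top fun u v => ?_
    rw [LinearMap.mem_ker, LinearMap.sub_apply, sub_eq_zero, LinearMap.id_apply]
    let e : ι → ZMod p := Pi.single i 1
    have h1 := hfix _ (Subgroup.commutator_mem_commutator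
      (Subgroup.mem_top (⟨tens e u, 0⟩ : CrossPower p ι))
      (Subgroup.mem_top (⟨tens e v, 0⟩ : CrossPower p ι)))
    rw [BaerGroup.commutatorElement_eq isAlt_sumCross] at h1
    have h2 : autCtr φ ((2 : ZMod p) • sumCross p ι (tens e u) (tens e v)) =
        (2 : ZMod p) • sumCross p ι (tens e u) (tens e v) := congrArg BaerGroup.ctr h1
    rw [map_smul] at h2
    have h3 := smul_right_injective (Fin 3 → ZMod p) (NeZero.ne (2 : ZMod p)) h2
    have he : e ⬝ᵥ e = 1 := by simp [e]
    simpa only [sumCross_tens_tens, he, one_smul] using h3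
  exact sub_eq_zero.1 (LinearMap.ker_eq_top.1 hS)

/-- Cross products of the columns of `g` form its cofactor matrix, of determinant `(det g)²`; take
determinants of both sides. The exponent `3` is odd, so the quadratic characters of `s` and `t`
survive. -/
theorem cube_det_eq {s t : ZMod p} {g θ : (Fin 3 → ZMod p) →ₗ[ZMod p] Fin 3 → ZMod p}
    (h : ∀ u v, s • (g u ⨯₃ g v) = t • θ (u ⨯₃ v)) :
    s ^ 3 * (LinearMap.toMatrix' g).det ^ 2 = t ^ 3 * (LinearMap.toMatrix' θ).det := by
  let x : Fin 3 → Fin 3 → ZMod p := fun i => g (Pi.single i 1)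
  let C : Matrix (Fin 3) (Fin 3) (ZMod p) := of ![x 1 ⨯₃ x 2, x 2 ⨯₃ x 0, x 0 ⨯₃ x 1]
  have hC : s • C = t • (LinearMap.toMatrix' θ)ᵀ := by
    have e0 : (Pi.single 1 1 ⨯₃ Pi.single 2 (1 : ZMod p)) = Pi.single 0 1 := by
      ext i; fin_cases i <;> simp [cross_apply]
    have e1 : (Pi.single 2 1 ⨯₃ Pi.single 0 (1 : ZMod p)) = Pi.single 1 1 := by
      ext i; fin_cases i <;> simp [cross_apply]
    have e2 : (Pi.single 0 1 ⨯₃ Pi.single 1 (1 : ZMod p)) = Pi.single 2 1 := by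
      ext i; fin_cases i <;> simp [cross_apply]
    ext i j
    have key : ∀ a b : Fin 3, (Pi.single a 1 ⨯₃ Pi.single b (1 : ZMod p)) = Pi.single i 1 →
        s * (x a ⨯₃ x b) j = t * LinearMap.toMatrix' θ j i := fun a b hab => by
      have := congrFun (h (Pi.single a 1) (Pi.single b 1)) j
      rw [hab] at this
      simpa [LinearMap.toMatrix'_apply, Pi.single_apply] using this
    fin_cases i
    · exact key _ _ e0
    · exact key _ _ e1
    · exact key _ _ e2
  have hdet := congrArg det hC
  rw [det_smul, det_smul, det_transpose, Fintype.card_fin] at hdet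
  rw [← hdet]
  congr 1
  have hG : (LinearMap.toMatrix' g) = (of x)ᵀ := by
    ext i j
    simp [x, LinearMap.toMatrix'_apply]
  rw [hG, det_transpose, det_fin_three, det_fin_three]
  simp only [C, of_apply, cross_apply, Matrix.cons_val]
  ring

/-- The correcting factor depends on `φ` alone, so all members of a decomposition change class
together or not at all. -/
theorem quadraticChar_mul_of_smul_lineSubgroup {φ : MulAut (CrossPower p ι)} {a c : ι → ZMod p}
    (ha : a ⬝ᵥ a ≠ 0) (hc : c ⬝ᵥ c ≠ 0) (h : φ • lineSubgroup a = lineSubgroup c) :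
    quadraticChar (ZMod p) (c ⬝ᵥ c) =
      quadraticChar (ZMod p) (a ⬝ᵥ a) *
        quadraticChar (ZMod p) (LinearMap.toMatrix' (autCtr φ)).det := by
  -- The map by which `φ` carries `a ⊗ F³` to `c ⊗ F³`, recovered by contracting with `c`.
  let g : (Fin 3 → ZMod p) →ₗ[ZMod p] Fin 3 → ZMod p :=
    (c ⬝ᵥ c)⁻¹ • (contract c ∘ₗ autVec φ ∘ₗ tens a)
  have hg : ∀ u, tens c (g u) = autVec φ (tens a u) := fun u => by
    have h1 : φ (⟨tens a u, 0⟩ : CrossPower p ι) ∈ lineSubgroup c :=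
      h ▸ Subgroup.smul_mem_pointwise_smul _ φ _ ⟨u, rfl⟩
    obtain ⟨v, hv⟩ := h1
    change tens c v = autVec φ (tens a u) at hv
    have : g u = v := by
      change (c ⬝ᵥ c)⁻¹ • contract c (autVec φ (tens a u)) = v
      rw [← hv, contract_tens, smul_smul, inv_mul_cancel₀ hc, one_smul]
    rw [this, hv]
  have hgθ : ∀ u v, (c ⬝ᵥ c) • (g u ⨯₃ g v) = (a ⬝ᵥ a) • autCtr φ (u ⨯₃ v) := fun u v => by
    rw [← sumCross_tens_tens, hg, hg, sumCross_autVec, sumCross_tens_tens, map_smul]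
  have hdet := cube_det_eq hgθ
  have hθ := det_autCtr_ne_zero φ
  have hgdet : (LinearMap.toMatrix' g).det ≠ 0 := by
    intro h0
    rw [h0, zero_pow two_ne_zero, mul_zero, eq_comm] at hdet
    exact mul_ne_zero (pow_ne_zero _ ha) hθ hdet
  have hχ := congrArg (quadraticChar (ZMod p)) hdet
  have cube : ∀ {x : ZMod p}, x ≠ 0 → quadraticChar (ZMod p) (x ^ 3) = quadraticChar (ZMod p) x :=
    fun {x} hx => by rw [pow_succ, map_mul, quadraticChar_sq_one' hx, one_mul]
  rwa [map_mul, map_mul, cube hc, cube ha, quadraticChar_sq_one' hgdet, mul_one] at hχ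

theorem IsFrame.lineSubgroup_injective {a : ι → ι → ZMod p} (ha : IsFrame a) :
    Function.Injective fun i => lineSubgroup (a i) := by
  intro i j hij
  by_contra hne
  have h1 : (⟨tens (a i) ![1, 0, 0], 0⟩ : CrossPower p ι) ∈ lineSubgroup (a j) :=
    (show lineSubgroup (a i) = lineSubgroup (a j) from hij) ▸ ⟨_, rfl⟩
  obtain ⟨u, hu⟩ := h1
  have h2 : contract (a i) (tens (a j) u) = contract (a i) (tens (a i) ![1, 0, 0]) :=
    congrArg _ hu
  rw [contract_tens, contract_tens, ha.ortho i j hne, zero_smul] at h2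
  have := congrFun h2 0
  simp [ha.norm_ne i, eq_comm] at this

theorem exists_perm_of_smul_eq {φ : MulAut (CrossPower p ι)} {a c : ι → ι → ZMod p}
    (ha : IsFrame a) (hc : IsFrame c) (h : φ • frameDecomposition a = frameDecomposition c) :
    ∃ σ : Equiv.Perm ι, ∀ i, quadraticChar (ZMod p) (c (σ i) ⬝ᵥ c (σ i)) =
      quadraticChar (ZMod p) (a i ⬝ᵥ a i) *
        quadraticChar (ZMod p) (LinearMap.toMatrix' (autCtr φ)).det := by
  have h1 : ∀ i, ∃ j, lineSubgroup (c j) = φ • lineSubgroup (a i) := fun i => by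
    have : φ • lineSubgroup (a i) ∈ frameDecomposition c :=
      h ▸ Set.smul_mem_smul_set ⟨i, rfl⟩
    exact this
  choose σ hσ using h1
  have hinj : Function.Injective σ := fun i j hij => by
    have h2 : φ • lineSubgroup (a i) = φ • lineSubgroup (a j) := by rw [← hσ, ← hσ, hij]
    exact ha.lineSubgroup_injective (MulAction.injective φ h2)
  refine ⟨Equiv.ofBijective σ (Finite.injective_iff_bijective.1 hinj), fun i => ?_⟩
  exact quadraticChar_mul_of_smul_lineSubgroup (ha.norm_ne i) (hc.norm_ne _) (hσ i).symm

theorem nonsquareCount_comp_perm (c : ι → ι → ZMod p) (σ : Equiv.Perm ι) :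
    nonsquareCount c =
      (Finset.univ.filter fun i => quadraticChar (ZMod p) (c (σ i) ⬝ᵥ c (σ i)) = -1).card := by
  rw [nonsquareCount, ← Fintype.card_subtype, ← Fintype.card_subtype]
  exact (Fintype.card_congr (σ.subtypeEquiv fun i => Iff.rfl)).symm

theorem nonsquareCount_add_of_neg {a c : ι → ι → ZMod p} (ha : IsFrame a) (σ : Equiv.Perm ι)
    (h : ∀ i, quadraticChar (ZMod p) (c (σ i) ⬝ᵥ c (σ i)) =
      -quadraticChar (ZMod p) (a i ⬝ᵥ a i)) :
    nonsquareCount a + nonsquareCount c = Fintype.card ι := by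
  rw [nonsquareCount_comp_perm c σ, nonsquareCount, ← Finset.card_univ,
    ← Finset.card_filter_add_card_filter_not
      (fun i => quadraticChar (ZMod p) (a i ⬝ᵥ a i) = -1) (s := Finset.univ)]
  congr 2
  ext i
  simp only [Finset.mem_filter, Finset.mem_univ, true_and]
  rw [h, neg_inj]
  exact quadraticChar_eq_one_iff_ne (ha.norm_ne i)

theorem nonsquareCount_eq_or_add_eq {φ : MulAut (CrossPower p ι)} {a c : ι → ι → ZMod p}
    (ha : IsFrame a) (hc : IsFrame c) (h : φ • frameDecomposition a = frameDecomposition c) :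
    nonsquareCount a = nonsquareCount c ∨ nonsquareCount a + nonsquareCount c = Fintype.card ι := by
  obtain ⟨σ, hσ⟩ := exists_perm_of_smul_eq ha hc h
  rcases quadraticChar_dichotomy (det_autCtr_ne_zero φ) with h1 | h1
  · left
    rw [nonsquareCount_comp_perm c σ]
    simp only [hσ, h1, mul_one]
    rfl
  · right
    exact nonsquareCount_add_of_neg ha σ fun i => by rw [hσ, h1, mul_neg_one]

theorem nonsquareCount_eq_of_mem [Nonempty ι] {φ : MulAut (CrossPower p ι)}
    (hφ : φ ∈ autCentralizingDerived (CrossPower p ι)) {a c : ι → ι → ZMod p}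
    (ha : IsFrame a) (hc : IsFrame c) (h : φ • frameDecomposition a = frameDecomposition c) :
    nonsquareCount a = nonsquareCount c := by
  obtain ⟨σ, hσ⟩ := exists_perm_of_smul_eq ha hc h
  rw [nonsquareCount_comp_perm c σ]
  simp only [hσ, autCtr_eq_id hφ, LinearMap.toMatrix'_id, det_one, map_one, mul_one]
  rfl

end Invariance

end Heisenberg

/-! ### Identification of the central power with its model. -/

namespace Heisenberg

open Matrix

section CentralPower

variable {p : ℕ} [Fact p.Prime] [NeZero (2 : ZMod p)] {k : ℕ}

/-- The canonical map from the direct power onto the model of the central power. -/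
noncomputable def powerHom (p k : ℕ) [Fact p.Prime] :
    (Fin k → FreeClassTwo p) →* CrossPower p (Fin k) where
  toFun h := ⟨fun i => (ofFree p (h i)).vec, ∑ i, (ofFree p (h i)).ctr⟩
  map_one' := by
    ext1
    · ext1 i; simp
    · simp
  map_mul' g h := by
    ext1
    · ext1 i; simp
    · simp [Finset.sum_add_distrib, sumCross_apply]

theorem powerHom_mulSingle (i : Fin k) (x : FreeClassTwo p) :
    powerHom p k (Pi.mulSingle i x) = ⟨Pi.single i (ofFree p x).vec, (ofFree p x).ctr⟩ := by
  have h : ∀ j, ofFree p ((Pi.mulSingle i x : Fin k → FreeClassTwo p) j) =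
      (Pi.mulSingle i (ofFree p x) : Fin k → Heis p) j := fun j => by
    by_cases hj : j = i
    · subst hj; simp
    · simp [hj]
  ext1
  · ext1 j
    change (ofFree p ((Pi.mulSingle i x : Fin k → FreeClassTwo p) j)).vec = _
    rw [h]
    by_cases hj : j = i
    · subst hj; simp
    · simp [hj]
  · change ∑ j, (ofFree p ((Pi.mulSingle i x : Fin k → FreeClassTwo p) j)).ctr = _
    rw [Finset.sum_eq_single i]
    · simp
    · intro j _ hj; simp [hj]
    · simp

theorem vec_ofFree_of_mem_center {x : FreeClassTwo p} (hx : x ∈ Subgroup.center _) :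
    (ofFree p x).vec = 0 := by
  refine eq_zero_of_cross_right fun v => ?_
  obtain ⟨y, hy⟩ := ofFree_surjective (⟨v, 0⟩ : Heis p)
  have h : Commute (ofFree p y) (ofFree p x) :=
    Commute.map (Subgroup.mem_center_iff.1 hx y) (ofFree p)
  rw [hy] at h
  exact (BaerGroup.commute_iff_of_isAlt isAlt_crossProduct).1 h.symm

theorem centralPowerKernel_le_ker : centralPowerKernel (FreeClassTwo p) k ≤ (powerHom p k).ker := by
  rw [centralPowerKernel, Subgroup.closure_le]
  rintro g ⟨i, j, -, x, hx, rfl⟩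
  have hx0 := vec_ofFree_of_mem_center hx
  change powerHom p k _ = 1
  rw [map_mul, powerHom_mulSingle, powerHom_mulSingle, map_inv]
  ext1 <;> simp [hx0]

/-- The central elements of the presented group. -/
noncomputable def ctrFree (p : ℕ) [Fact p.Prime] [NeZero (2 : ZMod p)] :
    Multiplicative (Fin 3 → ZMod p) →* FreeClassTwo p :=
  (freeEquiv p).symm.toMonoidHom.comp BaerGroup.ctrHom

theorem ctrFree_mem_center (w : Multiplicative (Fin 3 → ZMod p)) :
    ctrFree p w ∈ Subgroup.center (FreeClassTwo p) := by
  refine Subgroup.mem_center_iff.2 fun g => (freeEquiv p).injective ?_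
  have h : freeEquiv p (ctrFree p w) = BaerGroup.ctrHom w := (freeEquiv p).apply_symm_apply _
  rw [map_mul, map_mul, h]
  refine (BaerGroup.commute_iff.2 ?_).eq
  simp [BaerGroup.ctrHom]

theorem eq_ctrFree {x : FreeClassTwo p} (h : (ofFree p x).vec = 0) :
    x = ctrFree p (Multiplicative.ofAdd (ofFree p x).ctr) := by
  refine ((freeEquiv p).symm_apply_eq.2 ?_).symm
  ext1
  · exact h.symm
  · rfl

theorem mulSingle_mul_mem_centralPowerKernel {H : Type*} [Group H] (i j : Fin k) {x : H}
    (hx : x ∈ Subgroup.center H) :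
    (Pi.mulSingle i x * Pi.mulSingle j x⁻¹ : Fin k → H) ∈ centralPowerKernel H k := by
  rcases lt_trichotomy i j with h | rfl | h
  · exact Subgroup.subset_closure ⟨i, j, h, x, hx, rfl⟩
  · rw [← Pi.mulSingle_mul, mul_inv_cancel, Pi.mulSingle_one]
    exact one_mem _
  · have h1 := Subgroup.mem_center_iff.1 (mulSingle_mem_center j (inv_mem hx)) (Pi.mulSingle i x)
    rw [h1]
    exact Subgroup.subset_closure ⟨j, i, h, x⁻¹, inv_mem hx, by rw [inv_inv]⟩

/-- The central elements of the direct power. -/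
noncomputable def ctrPower (p k : ℕ) [Fact p.Prime] [NeZero (2 : ZMod p)] :
    Multiplicative (Fin k → Fin 3 → ZMod p) →* (Fin k → FreeClassTwo p) where
  toFun s i := ctrFree p (Multiplicative.ofAdd (s.toAdd i))
  map_one' := by ext1 i; simp
  map_mul' s t := by ext1 i; simp

theorem ctrPower_single (i : Fin k) (w : Fin 3 → ZMod p) :
    ctrPower p k (Multiplicative.ofAdd (Pi.single i w)) =
      Pi.mulSingle i (ctrFree p (Multiplicative.ofAdd w)) := by
  ext1 j
  change ctrFree p (Multiplicative.ofAdd ((Pi.single i w : Fin k → Fin 3 → ZMod p) j)) = _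
  by_cases hj : j = i
  · subst hj; simp
  · simp [hj]

/-- A tuple with sum zero is the sum of the differences of `s i` in position `i` and `s i` in
position `0`, and these differences lie in the kernel. -/
theorem ctrPower_mem [NeZero k] {s : Fin k → Fin 3 → ZMod p} (hs : ∑ i, s i = 0) :
    ctrPower p k (Multiplicative.ofAdd s) ∈ centralPowerKernel (FreeClassTwo p) k := by
  let B : AddSubgroup (Fin k → Fin 3 → ZMod p) :=
    Subgroup.toAddSubgroup' ((centralPowerKernel (FreeClassTwo p) k).comap (ctrPower p k))
  have hmem : ∀ s, s ∈ B ↔ ctrPower p k (Multiplicative.ofAdd s) ∈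
      centralPowerKernel (FreeClassTwo p) k := fun _ => Iff.rfl
  have hB : ∀ i w, Pi.single i w - Pi.single 0 w ∈ B := fun i w => by
    rw [hmem]
    rw [ofAdd_sub, map_div, ctrPower_single, ctrPower_single, div_eq_mul_inv, ← Pi.mulSingle_inv]
    exact mulSingle_mul_mem_centralPowerKernel _ _ (ctrFree_mem_center _)
  have hsum : s = ∑ i, (Pi.single i (s i) - Pi.single 0 (s i)) := by
    have h0 : ∑ i, (Pi.single 0 (s i) : Fin k → Fin 3 → ZMod p) = Pi.single 0 (∑ i, s i) :=
      (map_sum (AddMonoidHom.single (fun _ : Fin k => Fin 3 → ZMod p) 0) s Finset.univ).symm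
    rw [Finset.sum_sub_distrib, h0, hs, Pi.single_zero, sub_zero]
    exact (Finset.univ_sum_single s).symm
  have : s ∈ B := by
    rw [hsum]
    exact sum_mem fun i _ => hB i (s i)
  exact (hmem s).1 this

theorem ker_powerHom [NeZero k] :
    (powerHom p k).ker = centralPowerKernel (FreeClassTwo p) k := by
  refine le_antisymm (fun h hh => ?_) centralPowerKernel_le_ker
  have hv : ∀ i, (ofFree p (h i)).vec = 0 := fun i => congrFun (congrArg BaerGroup.vec hh) i
  have hw : ∑ i, (ofFree p (h i)).ctr = 0 := congrArg BaerGroup.ctr hh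
  have : h = ctrPower p k (Multiplicative.ofAdd fun i => (ofFree p (h i)).ctr) :=
    funext fun i => eq_ctrFree (hv i)
  rw [this]
  exact ctrPower_mem hw

theorem powerHom_surjective [NeZero k] : Function.Surjective (powerHom p k) := by
  intro x
  -- The whole central part is placed in position `0`.
  choose h hh using fun i : Fin k =>
    ofFree_surjective (⟨x.vec i, if i = 0 then x.ctr else 0⟩ : Heis p)
  refine ⟨h, ?_⟩
  ext1
  · ext1 i
    change (ofFree p (h i)).vec = _
    rw [hh]
  · change ∑ i, (ofFree p (h i)).ctr = _
    simp [hh]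

/-- The central power of the presented group is the model. -/
noncomputable def powerEquiv (p k : ℕ) [Fact p.Prime] [NeZero (2 : ZMod p)] [NeZero k] :
    CentralPower (FreeClassTwo p) k ≃* CrossPower p (Fin k) :=
  (QuotientGroup.quotientMulEquivOfEq ker_powerHom.symm).trans
    (QuotientGroup.quotientKerEquivOfSurjective _ powerHom_surjective)

theorem powerEquiv_component [NeZero k] (i : Fin k) (l : Fin 3) :
    powerEquiv p k (CentralPower.component i (PresentedGroup.of l)) =
      ⟨tens (Pi.single i 1) (Pi.single l 1), 0⟩ := by
  change powerHom p k (Pi.mulSingle i (PresentedGroup.of l)) = _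
  rw [powerHom_mulSingle, ofFree_of]
  ext1
  · ext1 j
    by_cases hj : j = i
    · subst hj; simp [tens_apply, gen]
    · simp [tens_apply, hj]
  · rfl

theorem map_componentSubgroup [NeZero k] (i : Fin k) :
    (powerEquiv p k).mapSubgroup (componentSubgroup (FreeClassTwo.gens p) i) =
      lineSubgroup (Pi.single i 1) := by
  rw [← closure_tens_single (by simp)]
  change Subgroup.map (powerEquiv p k).toMonoidHom _ = _
  rw [componentSubgroup, MonoidHom.map_closure, FreeClassTwo.gens, ← Set.range_comp,
    ← Set.range_comp]
  congr 2
  ext1 l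
  exact powerEquiv_component i l

theorem map_twistedSubgroup [NeZero k] (i j : Fin k) (s t : ZMod p)
    (h : (s • Pi.single i 1 + t • Pi.single j 1 : Fin k → ZMod p) ⬝ᵥ
      (s • Pi.single i 1 + t • Pi.single j 1) ≠ 0) :
    (powerEquiv p k).mapSubgroup (twistedSubgroup (FreeClassTwo.gens p) i j s t) =
      lineSubgroup (s • Pi.single i 1 + t • Pi.single j 1) := by
  rw [← closure_tens_single h]
  change Subgroup.map (powerEquiv p k).toMonoidHom _ = _
  rw [twistedSubgroup, MonoidHom.map_closure, FreeClassTwo.gens, ← Set.range_comp,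
    ← Set.range_comp]
  congr 2
  ext1 l
  change powerEquiv p k (CentralPower.component i (PresentedGroup.of l) ^ s.val *
    CentralPower.component j (PresentedGroup.of l) ^ t.val) = _
  have hval : ∀ (r : ZMod p) (v : Fin k → Fin 3 → ZMod p), r.val • v = r • v := fun r v => by
    rw [← Nat.cast_smul_eq_nsmul (ZMod p), ZMod.natCast_zmod_val]
  rw [map_mul, map_pow, map_pow, powerEquiv_component, powerEquiv_component]
  ext1
  · rw [BaerGroup.vec_mul, BaerGroup.vec_pow, BaerGroup.vec_pow, hval, hval, tens_add, tens_smul,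
      tens_smul, map_smul, map_smul]
  -- No central correction arises: both factors involve the same basis vector of `F³`, whose cross
  -- product with itself is `0`.
  · rw [BaerGroup.ctr_mul, BaerGroup.ctr_pow isAlt_sumCross, BaerGroup.ctr_pow isAlt_sumCross,
      BaerGroup.vec_pow, BaerGroup.vec_pow, hval, hval, map_smul, map_smul,
      LinearMap.smul_apply, sumCross_tens_tens]
    simp

end CentralPower

/-! ### The frames of the given decompositions. -/

section StandardFrame

variable {p : ℕ} [Fact p.Prime] {n : ℕ}

/-- The even index of the pair containing `i`. -/
def evenIndex (i : Fin (2 * n)) : Fin (2 * n) := ⟨2 * (i / 2), by omega⟩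

/-- The odd index of the pair containing `i`. -/
def oddIndex (i : Fin (2 * n)) : Fin (2 * n) := ⟨2 * (i / 2) + 1, by omega⟩

/-- The coefficient of the `i`-th vector of the standard frame at the even index. -/
def evenCoeff (α β : ZMod p) (m : ℕ) (i : Fin (2 * n)) : ZMod p :=
  if (i : ℕ) < 2 * m then if (i : ℕ) % 2 = 0 then α else β
  else if (i : ℕ) % 2 = 0 then 1 else 0

/-- The coefficient of the `i`-th vector of the standard frame at the odd index. -/
def oddCoeff (α β : ZMod p) (m : ℕ) (i : Fin (2 * n)) : ZMod p :=
  if (i : ℕ) < 2 * m then if (i : ℕ) % 2 = 0 then β else -α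
  else if (i : ℕ) % 2 = 0 then 0 else 1

/-- The frame of the decomposition with `m` twisted pairs. -/
def standardFrame (α β : ZMod p) (n m : ℕ) (i : Fin (2 * n)) : Fin (2 * n) → ZMod p :=
  evenCoeff α β m i • Pi.single (evenIndex i) 1 + oddCoeff α β m i • Pi.single (oddIndex i) 1

theorem standardFrame_dotProduct (α β : ZMod p) (m : ℕ) (i j : Fin (2 * n)) :
    standardFrame α β n m i ⬝ᵥ standardFrame α β n m j =
      if (i : ℕ) / 2 = (j : ℕ) / 2 then evenCoeff α β m i * evenCoeff α β m j +
        oddCoeff α β m i * oddCoeff α β m j else 0 := by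
  have h1 : (evenIndex i = evenIndex j) ↔ (i : ℕ) / 2 = (j : ℕ) / 2 := by
    simp [evenIndex]
  have h2 : (oddIndex i = oddIndex j) ↔ (i : ℕ) / 2 = (j : ℕ) / 2 := by
    simp [oddIndex]
  have h3 : evenIndex i ≠ oddIndex j := by simp [evenIndex, oddIndex]; omega
  have h4 : oddIndex i ≠ evenIndex j := by simp [evenIndex, oddIndex]; omega
  simp only [standardFrame, add_dotProduct, dotProduct_add, smul_dotProduct, dotProduct_smul,
    single_one_dotProduct, Pi.single_apply, h1, h2, h3, h4, smul_eq_mul, if_false, mul_zero,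
    add_zero, zero_add]
  split_ifs <;> ring

theorem standardFrame_norm (α β : ZMod p) (m : ℕ) (i : Fin (2 * n)) :
    standardFrame α β n m i ⬝ᵥ standardFrame α β n m i =
      if (i : ℕ) < 2 * m then α ^ 2 + β ^ 2 else 1 := by
  rw [standardFrame_dotProduct, if_pos rfl, evenCoeff, oddCoeff]
  split_ifs <;> ring

theorem isFrame_standardFrame {α β : ZMod p} (h : α ^ 2 + β ^ 2 ≠ 0) (m : ℕ) :
    IsFrame (standardFrame α β n m) := by
  refine ⟨fun i j hij => ?_, fun i => ?_⟩
  · rw [standardFrame_dotProduct]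
    split_ifs with hd
    · have hm : (i : ℕ) < 2 * m ↔ (j : ℕ) < 2 * m := by omega
      have hne : (i : ℕ) % 2 ≠ (j : ℕ) % 2 := fun h => hij (Fin.ext (by omega))
      simp only [evenCoeff, oddCoeff, hm]
      split_ifs <;> first | omega | ring
    · rfl
  · rw [standardFrame_norm]
    split_ifs
    · exact h
    · exact one_ne_zero

theorem nonsquareCount_standardFrame {α β : ZMod p} (h : ¬ IsSquare (α ^ 2 + β ^ 2)) {m : ℕ}
    (hm : m ≤ n) : nonsquareCount (standardFrame α β n m) = 2 * m := by
  have h0 : α ^ 2 + β ^ 2 ≠ 0 := fun h0 => h (h0 ▸ IsSquare.zero)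
  have h1 : quadraticChar (ZMod p) (α ^ 2 + β ^ 2) = -1 :=
    (quadraticChar_dichotomy h0).resolve_left fun h1 =>
      h ((quadraticChar_one_iff_isSquare h0).1 h1)
  have h2 : ∀ i : Fin (2 * n), quadraticChar (ZMod p)
      (standardFrame α β n m i ⬝ᵥ standardFrame α β n m i) = -1 ↔ (i : ℕ) < 2 * m := fun i => by
    rw [standardFrame_norm]
    split_ifs with hi
    · simp [h1, hi]
    · rw [map_one]
      simp only [hi, iff_false]
      decide
  simp only [nonsquareCount, h2]
  rw [Fin.card_filter_val_lt]
  omega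

variable [NeZero (2 : ZMod p)]

/-- The members of the decomposition `decompositionH`, indexed. -/
def standardMember (α β : ZMod p) (m : ℕ) (i : Fin (2 * n)) :
    Subgroup (FreeClassTwoPower p n) :=
  if (i : ℕ) < 2 * m then
    if (i : ℕ) % 2 = 0 then
      twistedSubgroup (FreeClassTwo.gens p) (evenIndex i) (oddIndex i) α β
    else twistedSubgroup (FreeClassTwo.gens p) (evenIndex i) (oddIndex i) β (-α)
  else componentSubgroup (FreeClassTwo.gens p) i

theorem decompositionH_eq_range (α β : ZMod p) (m : ℕ) :
    decompositionH α β n m = Set.range (standardMember α β m) := by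
  ext L
  constructor
  · rintro (⟨j, hjm, hjn, rfl | rfl⟩ | ⟨i, hi, rfl⟩)
    · refine ⟨⟨2 * j, by omega⟩, ?_⟩
      have h1 : evenIndex (⟨2 * j, by omega⟩ : Fin (2 * n)) = ⟨2 * j, by omega⟩ :=
        Fin.ext (by simp only [evenIndex]; omega)
      have h2 : oddIndex (⟨2 * j, by omega⟩ : Fin (2 * n)) = ⟨2 * j + 1, by omega⟩ :=
        Fin.ext (by simp only [oddIndex]; omega)
      rw [standardMember, if_pos (show 2 * j < 2 * m by omega),
        if_pos (show 2 * j % 2 = 0 by omega), h1, h2]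
    · refine ⟨⟨2 * j + 1, by omega⟩, ?_⟩
      have h1 : evenIndex (⟨2 * j + 1, by omega⟩ : Fin (2 * n)) = ⟨2 * j, by omega⟩ :=
        Fin.ext (by simp only [evenIndex]; omega)
      have h2 : oddIndex (⟨2 * j + 1, by omega⟩ : Fin (2 * n)) = ⟨2 * j + 1, by omega⟩ :=
        Fin.ext (by simp only [oddIndex]; omega)
      rw [standardMember, if_pos (show 2 * j + 1 < 2 * m by omega),
        if_neg (show ¬ (2 * j + 1) % 2 = 0 by omega), h1, h2]
    · exact ⟨i, by rw [standardMember, if_neg (by omega)]⟩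
  · rintro ⟨i, rfl⟩
    rw [standardMember]
    split_ifs with h1 h2
    · exact Or.inl ⟨i / 2, by omega, by omega, Or.inl rfl⟩
    · exact Or.inl ⟨i / 2, by omega, by omega, Or.inr rfl⟩
    · exact Or.inr ⟨i, by omega, rfl⟩

theorem map_standardMember [NeZero (2 * n)] {α β : ZMod p} (h : α ^ 2 + β ^ 2 ≠ 0) (m : ℕ)
    (i : Fin (2 * n)) : (powerEquiv p (2 * n)).mapSubgroup (standardMember α β m i) =
      lineSubgroup (standardFrame α β n m i) := by
  have hnorm := (isFrame_standardFrame (n := n) h m).norm_ne i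
  rw [standardMember]
  rw [standardFrame, evenCoeff, oddCoeff] at hnorm ⊢
  split_ifs at hnorm ⊢ with h1 h2 h2
  · exact map_twistedSubgroup _ _ _ _ hnorm
  · exact map_twistedSubgroup _ _ _ _ hnorm
  · rw [map_componentSubgroup, one_smul, zero_smul, add_zero]
    congr 2
    exact Fin.ext (by simp only [evenIndex]; omega)
  · rw [map_componentSubgroup, one_smul, zero_smul, zero_add]
    congr 2
    exact Fin.ext (by simp only [oddIndex]; omega)

theorem map_decompositionH [NeZero (2 * n)] {α β : ZMod p} (h : α ^ 2 + β ^ 2 ≠ 0) (m : ℕ) :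
    (powerEquiv p (2 * n)).mapSubgroup '' decompositionH α β n m =
      frameDecomposition (standardFrame α β n m) := by
  rw [decompositionH_eq_range α β m, ← Set.range_comp]
  congr 1
  ext1 i
  exact map_standardMember h m i

theorem nonsquareCount_similitude {ι : Type*} [Fintype ι] [DecidableEq ι] {T : Matrix ι ι (ZMod p)}
    {ω : ZMod p} (hω : quadraticChar (ZMod p) ω = -1) (hT : Tᵀ * T = ω • 1) {a : ι → ι → ZMod p}
    (ha : IsFrame a) :
    nonsquareCount a + nonsquareCount (fun i => T *ᵥ a i) = Fintype.card ι :=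
  nonsquareCount_add_of_neg ha (Equiv.refl ι) fun i => by
    rw [Equiv.refl_apply, mulVec_dotProduct_mulVec hT, map_mul, hω, neg_one_mul]

theorem IsFrame.similitude {ι : Type*} [Fintype ι] [DecidableEq ι] {T : Matrix ι ι (ZMod p)}
    {ω : ZMod p} (hω : ω ≠ 0) (hT : Tᵀ * T = ω • 1) {a : ι → ι → ZMod p} (ha : IsFrame a) :
    IsFrame fun i => T *ᵥ a i :=
  ⟨fun i j hij => by rw [mulVec_dotProduct_mulVec hT, ha.ortho i j hij, mul_zero],
    fun i => by rw [mulVec_dotProduct_mulVec hT]; exact mul_ne_zero hω (ha.norm_ne i)⟩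

theorem exists_aut_standardFrame_iff {α β : ZMod p} (h : ¬ IsSquare (α ^ 2 + β ^ 2)) {m m' : ℕ}
    (hm : m ≤ n) (hm' : m' ≤ n) :
    (∃ φ : MulAut (CrossPower p (Fin (2 * n))),
      φ • frameDecomposition (standardFrame α β n m) =
        frameDecomposition (standardFrame α β n m')) ↔ m' = m ∨ m' = n - m := by
  have h0 : α ^ 2 + β ^ 2 ≠ 0 := fun h0 => h (h0 ▸ IsSquare.zero)
  constructor
  · rintro ⟨φ, hφ⟩
    have := nonsquareCount_eq_or_add_eq (isFrame_standardFrame h0 m)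
      (isFrame_standardFrame h0 m') hφ
    rw [nonsquareCount_standardFrame h hm, nonsquareCount_standardFrame h hm',
      Fintype.card_fin] at this
    omega
  · rintro (rfl | rfl)
    · exact ⟨1, one_smul _ _⟩
    -- All vectors of the fully twisted frame have the nonsquare norm `α² + β²`, so the matrix with
    -- these columns is a similitude exchanging square and nonsquare norms. An isometry then moves
    -- the image frame, of count `2n - 2m`, to the standard one.
    · set T : Matrix (Fin (2 * n)) (Fin (2 * n)) (ZMod p) := (of (standardFrame α β n n))ᵀ
      have hT : Tᵀ * T = (α ^ 2 + β ^ 2) • 1 := by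
        rw [transpose_transpose, (isFrame_standardFrame h0 n).mul_transpose,
          smul_one_eq_diagonal]
        congr 1
        ext i
        rw [standardFrame_norm, if_pos i.2]
      have h1 : quadraticChar (ZMod p) (α ^ 2 + β ^ 2) = -1 :=
        (quadraticChar_dichotomy h0).resolve_left fun h1 =>
          h ((quadraticChar_one_iff_isSquare h0).1 h1)
      have ha := isFrame_standardFrame (n := n) h0 m
      have hcount := nonsquareCount_similitude h1 hT ha
      obtain ⟨ψ, -, hψ⟩ := exists_aut_of_nonsquareCount_eq (ha.similitude h0 hT)
        (isFrame_standardFrame h0 (n - m)) (by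
          rw [nonsquareCount_standardFrame h hm, Fintype.card_fin] at hcount
          rw [nonsquareCount_standardFrame h (Nat.sub_le n m)]
          omega)
      refine ⟨ψ * similitudeAut h0 hT, ?_⟩
      rw [mul_smul, similitudeAut_smul_frameDecomposition, hψ]

end StandardFrame

end Heisenberg

/-! ### Counting orbits. -/

section Orbits

variable {G G' : Type*} [Group G] [Group G']

theorem MulEquiv.symm_mapSubgroup_image (e : G ≃* G') (A : Set (Subgroup G)) :
    e.symm.mapSubgroup '' (e.mapSubgroup '' A) = A := by
  have : ∀ H, e.symm.mapSubgroup (e.mapSubgroup H) = H := fun H => e.mapSubgroup.symm_apply_apply H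
  rw [Set.image_image]
  simp only [this, Set.image_id']

theorem exists_aut_image_iff (e : G ≃* G') (A B : Set (Subgroup G)) :
    (∃ φ : MulAut G', φ • (e.mapSubgroup '' A) = e.mapSubgroup '' B) ↔
      ∃ φ : MulAut G, φ • A = B := by
  constructor
  · rintro ⟨φ, h⟩
    refine ⟨MulAut.congr e.symm φ, ?_⟩
    have := MulAut.congr_smul_image e.symm φ (e.mapSubgroup '' A)
    rwa [h, e.symm_mapSubgroup_image, e.symm_mapSubgroup_image] at this
  · rintro ⟨φ, rfl⟩
    exact ⟨MulAut.congr e φ, MulAut.congr_smul_image e φ A⟩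

theorem exists_mem_autCentralizingDerived_image_iff (e : G ≃* G') (A B : Set (Subgroup G)) :
    (∃ φ ∈ autCentralizingDerived G', φ • (e.mapSubgroup '' A) = e.mapSubgroup '' B) ↔
      ∃ φ ∈ autCentralizingDerived G, φ • A = B := by
  constructor
  · rintro ⟨φ, hφ, h⟩
    refine ⟨MulAut.congr e.symm φ, congr_mem_autCentralizingDerived e.symm hφ, ?_⟩
    have := MulAut.congr_smul_image e.symm φ (e.mapSubgroup '' A)
    rwa [h, e.symm_mapSubgroup_image, e.symm_mapSubgroup_image] at this
  · rintro ⟨φ, hφ, rfl⟩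
    exact ⟨MulAut.congr e φ, congr_mem_autCentralizingDerived e hφ, MulAut.congr_smul_image e φ A⟩

theorem orbit_eq_orbit_iff_exists {A : Subgroup (MulAut G)} {𝓗 𝓚 : Set (Subgroup G)} :
    MulAction.orbit A 𝓗 = MulAction.orbit A 𝓚 ↔ ∃ φ ∈ A, φ • 𝓗 = 𝓚 := by
  rw [eq_comm, MulAction.orbit_eq_iff]
  constructor
  · rintro ⟨φ, hφ⟩
    exact ⟨φ, φ.2, hφ⟩
  · rintro ⟨φ, hφ, h⟩
    exact ⟨⟨φ, hφ⟩, h⟩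

/-- If `D 0, …, D n` represent the orbits of `A`, where exactly `D 0, …, D (N - 1)` are needed,
then there are `N` orbits. -/
theorem ncard_fullyRefinedOrbits {A : Subgroup (MulAut G)} {D : ℕ → Set (Subgroup G)} {N : ℕ}
    (hD : ∀ m < N, IsFullyRefined (D m))
    (hex : ∀ 𝓚 : Set (Subgroup G), IsFullyRefined 𝓚 → ∃ m < N, ∃ φ ∈ A, φ • 𝓚 = D m)
    (hinj : ∀ m < N, ∀ m' < N, (∃ φ ∈ A, φ • D m = D m') → m = m') :
    (fullyRefinedOrbits A).ncard = N := by
  have h : fullyRefinedOrbits A = (fun m => MulAction.orbit A (D m)) '' (Finset.range N : Set ℕ) := by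
    ext O
    constructor
    · rintro ⟨𝓚, hK, rfl⟩
      obtain ⟨m, hm, hφ⟩ := hex 𝓚 hK
      exact ⟨m, by simpa using hm, (orbit_eq_orbit_iff_exists.2 hφ).symm⟩
    · rintro ⟨m, hm, rfl⟩
      exact ⟨D m, hD m (by simpa using hm), rfl⟩
  rw [h, Set.InjOn.ncard_image, Set.ncard_coe_finset, Finset.card_range]
  intro m hm m' hm' heq
  exact hinj m (by simpa using hm) m' (by simpa using hm') (orbit_eq_orbit_iff_exists.1 heq)

/-- The orbit counts, for a family of representatives of the orbits of the centralizer of the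
derived subgroup which are fused by the full automorphism group under `m ↦ n - m`. -/
theorem orbit_counts {n : ℕ} {D : ℕ → Set (Subgroup G)} (hD : ∀ m ≤ n, IsFullyRefined (D m))
    (hex : ∀ 𝓚 : Set (Subgroup G), IsFullyRefined 𝓚 →
      ∃ m ≤ n, ∃ φ ∈ autCentralizingDerived G, φ • 𝓚 = D m)
    (hinj : ∀ m ≤ n, ∀ m' ≤ n, (∃ φ ∈ autCentralizingDerived G, φ • D m = D m') → m = m')
    (hfuse : ∀ m ≤ n, ∀ m' ≤ n, (∃ φ : MulAut G, φ • D m = D m') ↔ m' = m ∨ m' = n - m) :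
    (∀ 𝓚 : Set (Subgroup G), IsFullyRefined 𝓚 →
      ∃! m : ℕ, m ≤ n ∧ ∃ φ ∈ autCentralizingDerived G, φ • 𝓚 = D m) ∧
    (fullyRefinedOrbits (autCentralizingDerived G)).ncard = 1 + n ∧
    (fullyRefinedOrbits (⊤ : Subgroup (MulAut G))).ncard = 1 + n / 2 := by
  refine ⟨fun 𝓚 hK => ?_, ?_, ?_⟩
  · obtain ⟨m, hm, φ, hφ, h⟩ := hex 𝓚 hK
    refine ⟨m, ⟨hm, φ, hφ, h⟩, ?_⟩
    rintro m' ⟨hm', φ', hφ', h'⟩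
    refine hinj m' hm' m hm ⟨φ * φ'⁻¹, mul_mem hφ (inv_mem hφ'), ?_⟩
    rw [← h', mul_smul, inv_smul_smul, h]
  · refine ncard_fullyRefinedOrbits (fun m hm => hD m (by omega)) (fun 𝓚 hK => ?_)
      (fun m hm m' hm' => hinj m (by omega) m' (by omega))
    obtain ⟨m, hm, h⟩ := hex 𝓚 hK
    exact ⟨m, by omega, h⟩
  · refine ncard_fullyRefinedOrbits (fun m hm => hD m (by omega)) (fun 𝓚 hK => ?_) ?_
    · obtain ⟨m, hm, φ, -, h⟩ := hex 𝓚 hK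
      by_cases hmn : m ≤ n / 2
      · exact ⟨m, by omega, φ, Subgroup.mem_top _, h⟩
      -- The representatives are `m ≤ n / 2`; larger parameters are reflected.
      · obtain ⟨ψ, hψ⟩ := (hfuse m hm (n - m) (by omega)).2 (Or.inr rfl)
        exact ⟨n - m, by omega, ψ * φ, Subgroup.mem_top _, by rw [mul_smul, h, hψ]⟩
    · rintro m hm m' hm' ⟨φ, -, h⟩
      have := (hfuse m (by omega) m' (by omega)).1 ⟨φ, h⟩
      omega

/-- In the trivial group the empty set already generates, so minimality excludes everything else. -/
theorem isFullyRefined_iff_of_subsingleton [Subsingleton G] {𝓚 : Set (Subgroup G)} :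
    IsFullyRefined 𝓚 ↔ 𝓚 = ∅ := by
  constructor
  · rintro ⟨⟨-, -, hm⟩, -⟩
    by_contra hne
    exact hm ∅ (Set.empty_ssubset.2 (Set.nonempty_iff_ne_empty.2 hne)) (Subsingleton.elim _ _)
  · rintro rfl
    refine ⟨⟨fun H hH => absurd hH (Set.notMem_empty H), Subsingleton.elim _ _, ?_⟩,
      fun H hH => absurd hH (Set.notMem_empty H)⟩
    exact fun 𝓙 hJ => absurd (Set.empty_subset 𝓙) hJ.2

end Orbits

/-! ### The theorem. -/

theorem theorem6 (p : ℕ) [Fact p.Prime] (hp : Odd p) (n : ℕ) (α β : ZMod p)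
    (hω : ¬ IsSquare (α ^ 2 + β ^ 2)) :
    (∀ m ≤ n, ∀ L ∈ decompositionH α β n m, Nonempty (L ≃* FreeClassTwo p)) ∧
    (∀ m ≤ n, IsFullyRefined (decompositionH α β n m)) ∧
    (∀ 𝓚 : Set (Subgroup (FreeClassTwoPower p n)), IsFullyRefined 𝓚 →
      ∃! m : ℕ, m ≤ n ∧
        ∃ φ ∈ autCentralizingDerived (FreeClassTwoPower p n), φ • 𝓚 = decompositionH α β n m) ∧
    (fullyRefinedOrbits (autCentralizingDerived (FreeClassTwoPower p n))).ncard = 1 + n ∧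
    (∀ m ≤ n, ∀ m' ≤ n,
      (∃ φ : MulAut (FreeClassTwoPower p n),
        φ • decompositionH α β n m = decompositionH α β n m') ↔ (m' = m ∨ m' = n - m)) ∧
    (fullyRefinedOrbits (⊤ : Subgroup (MulAut (FreeClassTwoPower p n)))).ncard = 1 + n / 2 := by
  suffices h : (∀ m ≤ n, ∀ L ∈ decompositionH α β n m, Nonempty (L ≃* FreeClassTwo p)) ∧
      (∀ m ≤ n, IsFullyRefined (decompositionH α β n m)) ∧
      (∀ 𝓚 : Set (Subgroup (FreeClassTwoPower p n)), IsFullyRefined 𝓚 →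
        ∃ m ≤ n, ∃ φ ∈ autCentralizingDerived (FreeClassTwoPower p n),
          φ • 𝓚 = decompositionH α β n m) ∧
      (∀ m ≤ n, ∀ m' ≤ n, (∃ φ ∈ autCentralizingDerived (FreeClassTwoPower p n),
        φ • decompositionH α β n m = decompositionH α β n m') → m = m') ∧
      (∀ m ≤ n, ∀ m' ≤ n,
        (∃ φ : MulAut (FreeClassTwoPower p n),
          φ • decompositionH α β n m = decompositionH α β n m') ↔ (m' = m ∨ m' = n - m)) by
    obtain ⟨h1, h2, h3, h4, h5⟩ := h
    obtain ⟨c1, c2, c3⟩ := orbit_counts h2 h3 h4 h5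
    exact ⟨h1, h2, c1, c2, h5, c3⟩
  have h0 : α ^ 2 + β ^ 2 ≠ 0 := fun h0 => hω (h0 ▸ IsSquare.zero)
  have : NeZero (2 : ZMod p) := ⟨fun h2 => by
    have h2' : ((2 : ℕ) : ZMod p) = 0 := by exact_mod_cast h2
    have := Nat.le_of_dvd two_pos ((ZMod.natCast_eq_zero_iff 2 p).1 h2')
    have := (Fact.out : p.Prime).two_le
    have : p = 2 := by omega
    exact absurd hp (by rw [this]; decide)⟩
  -- For `n = 0` the group `P` is trivial, whereas the model with empty index set still has centre
  -- `F³`; this case is separate.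
  obtain rfl | hn := Nat.eq_zero_or_pos n
  · have hsub : Subsingleton (FreeClassTwoPower p 0) :=
      ⟨fun x y => by
        obtain ⟨x, rfl⟩ := QuotientGroup.mk_surjective x
        obtain ⟨y, rfl⟩ := QuotientGroup.mk_surjective y
        exact congrArg _ (funext fun i => i.elim0)⟩
    have hempty : ∀ m, decompositionH α β 0 m = ∅ := fun m => by
      rw [Heisenberg.decompositionH_eq_range α β m]
      exact Set.range_eq_empty_iff.2 (inferInstanceAs (IsEmpty (Fin 0)))
    refine ⟨fun m hm L hL => ?_, fun m hm => ?_, fun 𝓚 hK => ?_, ?_, ?_⟩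
    · rw [hempty m] at hL
      exact absurd hL (Set.notMem_empty L)
    · exact isFullyRefined_iff_of_subsingleton.2 (hempty m)
    · refine ⟨0, le_rfl, 1, one_mem _, ?_⟩
      rw [one_smul, hempty 0]
      exact isFullyRefined_iff_of_subsingleton.1 hK
    · intro m hm m' hm' _
      omega
    · intro m hm m' hm'
      have : m = m' := by omega
      subst this
      exact ⟨fun _ => Or.inl rfl, fun _ => ⟨1, one_smul _ _⟩⟩
  · have : NeZero (2 * n) := ⟨by omega⟩
    let e := Heisenberg.powerEquiv p (2 * n)
    have he : ∀ m, e.mapSubgroup '' decompositionH α β n m =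
        Heisenberg.frameDecomposition (Heisenberg.standardFrame α β n m) :=
      fun m => Heisenberg.map_decompositionH h0 m
    have hframe : ∀ m, Heisenberg.IsFrame (Heisenberg.standardFrame α β n m) :=
      Heisenberg.isFrame_standardFrame h0
    refine ⟨fun m hm L hL => ?_, fun m hm => ?_, fun 𝓚 hK => ?_, fun m hm m' hm' h => ?_,
      fun m hm m' hm' => ?_⟩
    · have h1 : e.mapSubgroup L ∈ e.mapSubgroup '' decompositionH α β n m := ⟨L, hL, rfl⟩
      rw [he m] at h1
      obtain ⟨i, hi⟩ := h1
      exact ⟨(e.subgroupMap L).trans ((MulEquiv.subgroupCongr hi.symm).trans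
        ((Heisenberg.lineEquiv ((hframe m).norm_ne i)).symm.trans
          (Heisenberg.freeEquiv p).symm))⟩
    · have h1 := (hframe m).isFullyRefined.map e.symm
      rwa [← he m, e.symm_mapSubgroup_image] at h1
    · obtain ⟨a, ha, hKa⟩ := Heisenberg.exists_isFrame (hK.map e)
      -- The parameter is half the number of nonsquare norms.
      obtain ⟨m, hm⟩ := ha.even_nonsquareCount
      have hle := Heisenberg.nonsquareCount_le a
      rw [Fintype.card_fin] at hle
      have hmn : m ≤ n := by omega
      refine ⟨m, hmn, ?_⟩
      rw [← exists_mem_autCentralizingDerived_image_iff e, hKa, he m]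
      refine Heisenberg.exists_aut_of_nonsquareCount_eq ha (hframe m) ?_
      rw [Heisenberg.nonsquareCount_standardFrame hω hmn]
      omega
    · rw [← exists_mem_autCentralizingDerived_image_iff e, he m, he m'] at h
      obtain ⟨φ, hφ, h⟩ := h
      have := Heisenberg.nonsquareCount_eq_of_mem hφ (hframe m) (hframe m') h
      rw [Heisenberg.nonsquareCount_standardFrame hω hm,
        Heisenberg.nonsquareCount_standardFrame hω hm'] at this
      omega
    · rw [← exists_aut_image_iff e, he m, he m']
      exact Heisenberg.exists_aut_standardFrame_iff hω hm hm'
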